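/- **Theorem (Auslander–Buchsbaum formula).** Let $(R,\mathfrak m,k)$ be a commutative Noetherian local ring and let $C$ be a semidualizing $R$-module, i.e. a finitely generated $R$-module such that the homothety map $R\to\operatorname{Hom}_R(C,C)$ is an isomorphism and $\operatorname{Ext}^i_R(C,C)=0$ for all $i>0$. For a complex $X$ of $R$-modules (with differentials $\partial_i\colon X_i\to X_{i-1}$, $i\in\mathbb Z$) put $\sup X=\sup\{i\in\mathbb Z\mid X_i\neq 0\}$ and $\operatorname{hsup}X=\sup\{i\in\mathbb Z\mid \operatorname{H}_i(X)\neq 0\}$; call $X$ minimal if $\partial_i(X_i)\subseteq\mathfrak m X_{i-1}$ for all $i$. A $C$-quasi-projective resolution of an $R$-module $M$ is a bounded complex $P$ of projective $R$-modules such that $P\otimes_R C$ is not acyclic and, for every $i\in\mathbb Z$, $\operatorname{H}_i(P\otimes_R C)\cong M^{\oplus a_i}$ for some integer $a_i\ge 0$. For $M\neq 0$ put $$C\text{-}\mathrm{qpd}_R\,M=\inf\{\sup(P\otimes_RC)-\operatorname{hsup}(P\otimes_RC)\mid P\text{ is a } C\text{-quasi-projective resolution of }M\},$$ which is $\infty$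 if no such resolution exists. Let $M$ be a nonzero finitely generated $R$-module with $C\text{-}\mathrm{qpd}_R\,M<\infty$. Then $$C\text{-}\mathrm{qpd}_R\,M=\operatorname{depth}R-\operatorname{depth}_R M,$$ where $\operatorname{depth}_R N=\inf\{i\ge 0\mid\operatorname{Ext}^i_R(k,N)\neq0\}$. Moreover, every minimal $C$-quasi-projective resolution $F$ of $M$ satisfies $$C\text{-}\mathrm{qpd}_R\,M=\sup F-\operatorname{hsup}F.$$ -/

import Mathlib

open CategoryTheory

universe u

noncomputable section

/-- A semidualizing module over a commutative Noetherian ring `R`: a finitely generated module `C`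
such that the homothety map `R → Hom_R(C, C)` is bijective and `Ext^i_R(C, C) = 0` for `i > 0`. -/
structure IsSemidualizing (R : Type u) [CommRing R] (C : Type u) [AddCommGroup C] [Module R C] :
    Prop where
  finite : Module.Finite R C
  homothety_bijective : Function.Bijective (LinearMap.lsmul R C : R → (C →ₗ[R] C))
  ext_vanishing : ∀ i : ℕ, 0 < i →
    Subsingleton (Abelian.Ext (ModuleCat.of R C) (ModuleCat.of R C) i)

/-- The depth of a module over a local ring: the least `i` such that `Ext^i_R(k, M) ≠ 0`, where `k`
is the residue field (and `⊤` if there is no such `i`, e.g. for `M = 0`). -/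
def localDepth (R : Type u) [CommRing R] [IsLocalRing R] (M : Type u) [AddCommGroup M]
    [Module R M] : EReal :=
  ⨅ (i : ℕ) (_ : Nontrivial (Abelian.Ext (ModuleCat.of R (IsLocalRing.ResidueField R))
    (ModuleCat.of R M) i)), (i : EReal)

/-- Complexes of `R`-modules indexed by `ℤ`, with differentials `X_{i+1} ⟶ X_i`. -/
abbrev ModuleComplex (R : Type u) [CommRing R] := ChainComplex (ModuleCat.{u} R) ℤ

namespace ModuleComplex

variable {R : Type u} [CommRing R]

/-- `sup X = sup {i ∈ ℤ | X_i ≠ 0}`, equal to `⊥` for the zero complex. -/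
def supDeg (X : ModuleComplex R) : EReal :=
  ⨆ (i : ℤ) (_ : Nontrivial (X.X i)), ((i : ℝ) : EReal)

/-- `inf X = inf {i ∈ ℤ | X_i ≠ 0}`, equal to `⊤` for the zero complex. -/
def infDeg (X : ModuleComplex R) : EReal :=
  ⨅ (i : ℤ) (_ : Nontrivial (X.X i)), ((i : ℝ) : EReal)

/-- `hsup X = sup {i ∈ ℤ | H_i(X) ≠ 0}`, equal to `⊥` for an acyclic complex. -/
def hsupDeg (X : ModuleComplex R) : EReal :=
  ⨆ (i : ℤ) (_ : Nontrivial (X.homology i)), ((i : ℝ) : EReal)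

/-- A complex that is bounded above (`sup X < ∞`) and bounded below (`inf X > -∞`). -/
def IsBounded (X : ModuleComplex R) : Prop :=
  X.supDeg < ⊤ ∧ ⊥ < X.infDeg

/-- The complex `X ⊗_R C`. -/
def tensor (X : ModuleComplex R) (C : Type u) [AddCommGroup C] [Module R C] : ModuleComplex R :=
  ((MonoidalCategory.tensorRight (ModuleCat.of R C)).mapHomologicalComplex
    (ComplexShape.down ℤ)).obj X

/-- A complex over a local ring `(R, 𝔪)` is minimal if `∂(X_i) ⊆ 𝔪 X_{i-1}` for all `i`. -/
def IsMinimal [IsLocalRing R] (X : ModuleComplex R) : Prop :=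
  ∀ i : ℤ, LinearMap.range (X.d i (i - 1)).hom ≤
    IsLocalRing.maximalIdeal R • (⊤ : Submodule R (X.X (i - 1)))

end ModuleComplex

/-- `P` is a `C`-quasi-projective resolution of `M`: a bounded complex of projective modules such
that `P ⊗_R C` is not acyclic and each homology module of `P ⊗_R C` is isomorphic to `M^n` for some
`n ≥ 0` (depending on the degree). -/
structure IsCQuasiProjectiveResolution (R : Type u) [CommRing R] (C M : Type u)
    [AddCommGroup C] [Module R C] [AddCommGroup M] [Module R M] (P : ModuleComplex R) : Prop where
  bounded : P.IsBounded
  projective : ∀ i : ℤ, Module.Projective R (P.X i)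
  not_acyclic : ¬ (P.tensor C).Acyclic
  homology_iso : ∀ i : ℤ, ∃ n : ℕ, Nonempty ((P.tensor C).homology i ≃ₗ[R] (Fin n → M))

open Classical in
/-- The `C`-quasi-projective dimension of `M`: the infimum of `sup (P ⊗ C) - hsup (P ⊗ C)` over all
`C`-quasi-projective resolutions `P` of `M` (so `⊤` if there is none), and `⊥` if `M = 0`. -/
def cQuasiProjectiveDim (R : Type u) [CommRing R] (C M : Type u)
    [AddCommGroup C] [Module R C] [AddCommGroup M] [Module R M] : EReal :=
  if Subsingleton M then ⊥ else
    ⨅ (P : ModuleComplex R) (_ : IsCQuasiProjectiveResolution R C M P),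
      (P.tensor C).supDeg - (P.tensor C).hsupDeg

end

/-! ### Long exact sequences and dimension shifting for `Ext` of unbundled modules. -/

noncomputable section ExtToolkit

variable {R : Type u} [CommRing R]

/-! Let c = depth C. Applying Hom(-, C) to presentations of C and using R ≅ Hom(C, C) gives depth R
= c (`IsSemidualizing.exists_depth`). For a resolution P of M let t be its top degree and s the top
degree of the homology of P ⊗ C. Everything depends on whether the top differential d : P_t →
P_{t-1} is injective modulo 𝔪.

If it is not, some x ∉ 𝔪P_t has dx ∈ 𝔪P_{t-1}. Then C → P_t ⊗ C, y ↦ x ⊗ y, is split, while its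
composite with d ⊗ C is zero on Ext(k, -), so Ext^c(k, d ⊗ C) is not injective. All terms P_i ⊗ C
have Ext^j(k, -) = 0 for j < c and all homology is a sum of copies of M, so chasing depths along
cycles and boundaries (`exists_depth_of_not_injective`) gives c = depth M + (t - s).

If it is, d splits and P can be shortened without changing s (`exists_shorter`). The terms of P need
not be finitely generated, but the homology of P is finite, so coker d is finite up to projective
summands. As Tor₁(k, coker d) = 0, coker d is projective, and a Nakayama argument for arbitrary
projectives splits d.

Since s ≤ t, shortening stops, and it stops in the first case. Hence t - s ≥ depth R - depth M for
every resolution, with equality for some resolution. A minimal resolution is in the first case from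
the start. Finally `thick_homology` and `nontrivial_homology`, through H(P) → Hom(C, H(P ⊗ C)), show
hsup P = hsup (P ⊗ C), and sup P = sup (P ⊗ C) because P_t ⊗ C ≠ 0. -/

/-- `Ext^n_R(L, N)` for unbundled modules. -/
abbrev ModExt (R : Type u) [CommRing R] (L N : Type u) [AddCommGroup L] [Module R L]
    [AddCommGroup N] [Module R N] (n : ℕ) : Type u :=
  Abelian.Ext (ModuleCat.of R L) (ModuleCat.of R N) n

namespace ModExt

variable {L L' A B D : Type u} [AddCommGroup L] [Module R L] [AddCommGroup L'] [Module R L']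
  [AddCommGroup A] [Module R A] [AddCommGroup B] [Module R B] [AddCommGroup D] [Module R D]

/-- Postcomposition with a linear map on `Ext`. -/
def map (L : Type u) [AddCommGroup L] [Module R L] (n : ℕ) (f : A →ₗ[R] B) :
    ModExt R L A n →ₗ[R] ModExt R L B n :=
  (Abelian.Ext.mk₀ (ModuleCat.ofHom f)).postcompOfLinear R (ModuleCat.of R L) (add_zero n)

lemma map_apply (n : ℕ) (f : A →ₗ[R] B) (x : ModExt R L A n) :
    map L n f x = x.comp (Abelian.Ext.mk₀ (ModuleCat.ofHom f)) (add_zero n) := rfl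

lemma map_id_apply (n : ℕ) (x : ModExt R L A n) : map L n (LinearMap.id : A →ₗ[R] A) x = x := by
  rw [map_apply, ModuleCat.ofHom_id]
  exact Abelian.Ext.comp_mk₀_id x

lemma map_comp_apply (n : ℕ) (f : A →ₗ[R] B) (g : B →ₗ[R] D) (x : ModExt R L A n) :
    map L n (g ∘ₗ f) x = map L n g (map L n f x) := by
  simp [map_apply, ModuleCat.ofHom_comp]

lemma map_add (n : ℕ) (f g : A →ₗ[R] B) : map L n (f + g) = map L n f + map L n g := by
  ext x
  simp [map_apply, ModuleCat.ofHom_add, Abelian.Ext.mk₀_add]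

lemma map_zero (n : ℕ) : map L n (0 : A →ₗ[R] B) = 0 := by
  ext x
  have : ModuleCat.ofHom (0 : A →ₗ[R] B) = 0 := rfl
  simp [map_apply, this]

lemma map_smul (n : ℕ) (r : R) (f : A →ₗ[R] B) : map L n (r • f) = r • map L n f := by
  ext x
  have : ModuleCat.ofHom (r • f) = r • ModuleCat.ofHom f := rfl
  simp [map_apply, this, Abelian.Ext.mk₀_smul]

lemma map_sum (n : ℕ) {ι : Type*} (s : Finset ι) (f : ι → A →ₗ[R] B) :
    map L n (∑ i ∈ s, f i) = ∑ i ∈ s, map L n (f i) := by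
  classical
  induction s using Finset.induction with
  | empty => simpa using map_zero n
  | insert i s hi ih => rw [Finset.sum_insert hi, Finset.sum_insert hi, map_add, ih]

/-- Linear equivalences induce equivalences on `Ext` in the second argument. -/
def congr (L : Type u) [AddCommGroup L] [Module R L] (n : ℕ) (e : A ≃ₗ[R] B) :
    ModExt R L A n ≃ₗ[R] ModExt R L B n :=
  LinearEquiv.ofLinearMap (map L n e.toLinearMap) (map L n e.symm.toLinearMap)
    (by
      ext x
      rw [LinearMap.comp_apply, ← map_comp_apply]
      simp [map_id_apply])
    (by
      ext x
      rw [LinearMap.comp_apply, ← map_comp_apply]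
      simp [map_id_apply])

/-- `Ext^0` is the module of linear maps. -/
def zeroEquiv (L A : Type u) [AddCommGroup L] [Module R L] [AddCommGroup A] [Module R A] :
    ModExt R L A 0 ≃ₗ[R] (L →ₗ[R] A) :=
  Abelian.Ext.linearEquiv₀.trans ModuleCat.homLinearEquiv

lemma zeroEquiv_map (f : A →ₗ[R] B) (x : ModExt R L A 0) :
    zeroEquiv L B (map L 0 f x) = f ∘ₗ zeroEquiv L A x := by
  obtain ⟨y, rfl⟩ := (zeroEquiv (R := R) L A).symm.surjective x
  rw [LinearEquiv.apply_symm_apply, ← LinearEquiv.eq_symm_apply]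
  have h (E : Type u) [AddCommGroup E] [Module R E] (z : L →ₗ[R] E) :
    (zeroEquiv (R := R) L E).symm z = Abelian.Ext.mk₀ (ModuleCat.ofHom z) := rfl
  rw [h, h, map_apply, Abelian.Ext.mk₀_comp_mk₀, ModuleCat.ofHom_comp]

section ShortExact

variable {f : A →ₗ[R] B} {g : B →ₗ[R] D}

lemma shortExact (hf : Function.Injective f) (hg : Function.Surjective g)
    (h : Function.Exact f g) :
    (ModuleCat.shortComplexOfCompEqZero f g h.linearMap_comp_eq_zero).ShortExact :=
  ModuleCat.shortComplex_shortExact _ h hf hg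

lemma exact_map (L : Type u) [AddCommGroup L] [Module R L] (hf : Function.Injective f)
    (hg : Function.Surjective g)
    (h : Function.Exact f g) (n : ℕ) : Function.Exact (map L n f) (map L n g) := by
  intro x
  refine ⟨fun hx ↦ Abelian.Ext.covariant_sequence_exact₂ (ModuleCat.of R L)
    (shortExact hf hg h) x hx, ?_⟩
  rintro ⟨y, rfl⟩
  rw [← map_comp_apply, h.linearMap_comp_eq_zero, map_zero, LinearMap.zero_apply]

lemma exists_connecting (L : Type u) [AddCommGroup L] [Module R L] (hf : Function.Injective f)
    (hg : Function.Surjective g) (h : Function.Exact f g) (n : ℕ) :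
    ∃ δ : ModExt R L D n →ₗ[R] ModExt R L A (n + 1),
      Function.Exact (map L n g) δ ∧ Function.Exact δ (map L (n + 1) f) := by
  have hS := shortExact hf hg h
  refine ⟨hS.extClass.postcompOfLinear R (ModuleCat.of R L) rfl, fun x ↦ ⟨fun hx ↦ ?_, ?_⟩,
    fun x ↦ ⟨fun hx ↦ ?_, ?_⟩⟩
  · exact Abelian.Ext.covariant_sequence_exact₃ (ModuleCat.of R L) hS x rfl hx
  · rintro ⟨y, rfl⟩
    change (y.comp (Abelian.Ext.mk₀ (ModuleCat.ofHom g)) (add_zero n)).comp hS.extClass rfl = 0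
    rw [Abelian.Ext.comp_assoc_of_second_deg_zero]
    erw [hS.comp_extClass]
    simp
  · exact Abelian.Ext.covariant_sequence_exact₁ (ModuleCat.of R L) hS x hx rfl
  · rintro ⟨y, rfl⟩
    change (y.comp hS.extClass rfl).comp (Abelian.Ext.mk₀ (ModuleCat.ofHom f)) (add_zero _) = 0
    rw [Abelian.Ext.comp_assoc_of_third_deg_zero]
    erw [hS.extClass_comp]
    simp

end ShortExact

/-- Dimension shifting in the first argument: for `0 → L' → F → L → 0` with `F` projective, the
connecting map `Ext^n(L', A) → Ext^(n+1)(L, A)` is surjective, with kernel the image of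
`Ext^n(F, A)`. -/
lemma exists_shift {F : Type u} [AddCommGroup F] [Module R F] [Module.Projective R F]
    {f : L' →ₗ[R] F} {g : F →ₗ[R] L} (hf : Function.Injective f) (hg : Function.Surjective g)
    (h : Function.Exact f g) (A : Type u) [AddCommGroup A] [Module R A] (n : ℕ) :
    ∃ δ : ModExt R L' A n →ₗ[R] ModExt R L A (n + 1), Function.Surjective δ ∧
      ∀ x, δ x = 0 ↔ ∃ y : ModExt R F A n,
        (Abelian.Ext.mk₀ (ModuleCat.ofHom f)).comp y (zero_add n) = x := by
  have hS := shortExact hf hg h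
  have hP : Projective (ModuleCat.of R F) := inferInstance
  refine ⟨hS.extClass.precompOfLinear R (ModuleCat.of R A) (add_comm 1 n), fun x ↦ ?_,
    fun x ↦ ⟨fun hx ↦ ?_, ?_⟩⟩
  · exact Abelian.Ext.contravariant_sequence_exact₃ hS _ x
      (Abelian.Ext.eq_zero_of_projective (P := ModuleCat.of R F) _) (add_comm 1 n)
  · exact Abelian.Ext.contravariant_sequence_exact₁ hS _ x (add_comm 1 n) hx
  · rintro ⟨y, rfl⟩
    change hS.extClass.comp ((Abelian.Ext.mk₀ (ModuleCat.ofHom f)).comp y (zero_add n)) (add_comm 1 n) = 0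
    rw [← Abelian.Ext.comp_assoc_of_second_deg_zero]
    erw [hS.extClass_comp]
    simp

lemma exists_shift_one {F : Type u} [AddCommGroup F] [Module R F] [Module.Projective R F]
    {f : L' →ₗ[R] F} {g : F →ₗ[R] L} (hf : Function.Injective f) (hg : Function.Surjective g)
    (h : Function.Exact f g) (A : Type u) [AddCommGroup A] [Module R A] :
    ∃ δ : (L' →ₗ[R] A) →ₗ[R] ModExt R L A 1, Function.Surjective δ ∧
      ∀ x, δ x = 0 ↔ ∃ y : F →ₗ[R] A, y ∘ₗ f = x := by
  obtain ⟨δ, hδ, hδ'⟩ := exists_shift hf hg h A 0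
  refine ⟨δ ∘ₗ (zeroEquiv L' A).symm.toLinearMap,
    hδ.comp (zeroEquiv L' A).symm.surjective, fun x ↦ ?_⟩
  have hz (K : Type u) [AddCommGroup K] [Module R K] (z : K →ₗ[R] A) :
    (zeroEquiv (R := R) K A).symm z = Abelian.Ext.mk₀ (ModuleCat.ofHom z) := rfl
  have key (y : F →ₗ[R] A) : (Abelian.Ext.mk₀ (ModuleCat.ofHom f)).comp
      ((zeroEquiv F A).symm y) (zero_add 0) = (zeroEquiv L' A).symm (y ∘ₗ f) := by
    rw [hz, hz, Abelian.Ext.mk₀_comp_mk₀, ModuleCat.ofHom_comp]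
  refine (hδ' _).trans ⟨?_, ?_⟩
  · rintro ⟨y, hy⟩
    obtain ⟨y, rfl⟩ := (zeroEquiv F A).symm.surjective y
    rw [key] at hy
    exact ⟨y, (zeroEquiv L' A).symm.injective hy⟩
  · rintro ⟨y, rfl⟩
    exact ⟨(zeroEquiv F A).symm y, key y⟩

lemma exists_shift_equiv {F : Type u} [AddCommGroup F] [Module R F] [Module.Projective R F]
    {f : L' →ₗ[R] F} {g : F →ₗ[R] L} (hf : Function.Injective f) (hg : Function.Surjective g)
    (h : Function.Exact f g) (A : Type u) [AddCommGroup A] [Module R A] (n : ℕ) :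
    Nonempty (ModExt R L' A (n + 1) ≃ₗ[R] ModExt R L A (n + 1 + 1)) := by
  obtain ⟨δ, hδ, hδ'⟩ := exists_shift hf hg h A (n + 1)
  refine ⟨LinearEquiv.ofBijective δ ⟨?_, hδ⟩⟩
  rw [injective_iff_map_eq_zero]
  intro x hx
  obtain ⟨y, rfl⟩ := (hδ' x).1 hx
  have hP : Projective (ModuleCat.of R F) := inferInstance
  rw [Abelian.Ext.eq_zero_of_projective (P := ModuleCat.of R F) y]
  simp

section Vanishing

variable {f : A →ₗ[R] B} {g : B →ₗ[R] D} (hf : Function.Injective f)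
  (hg : Function.Surjective g) (h : Function.Exact f g)

lemma subsingleton_congr (e : A ≃ₗ[R] B) (n : ℕ) :
    Subsingleton (ModExt R L A n) ↔ Subsingleton (ModExt R L B n) :=
  (congr L n e).toEquiv.subsingleton_congr

lemma subsingleton_of_exact {A B D : Type*} [AddCommGroup A] [AddCommGroup B] [AddCommGroup D]
    [Module R A] [Module R B] [Module R D] {f : A →ₗ[R] B} {g : B →ₗ[R] D}
    (h : Function.Exact f g) (hA : Subsingleton A) (hD : Subsingleton D) : Subsingleton B := by
  refine ⟨fun x y ↦ ?_⟩
  have key (z : B) : z = 0 := by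
    obtain ⟨a, rfl⟩ := (h z).1 (Subsingleton.elim _ _)
    rw [Subsingleton.elim a 0, _root_.map_zero]
  rw [key x, key y]

include hf hg h

lemma subsingleton_mid {n : ℕ} (hA : Subsingleton (ModExt R L A n))
    (hD : Subsingleton (ModExt R L D n)) : Subsingleton (ModExt R L B n) :=
  subsingleton_of_exact (exact_map L hf hg h n) hA hD

lemma subsingleton_right {n : ℕ} (hB : Subsingleton (ModExt R L B n))
    (hA : Subsingleton (ModExt R L A (n + 1))) : Subsingleton (ModExt R L D n) := by
  obtain ⟨δ, h₁, -⟩ := exists_connecting L hf hg h n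
  exact subsingleton_of_exact h₁ hB hA

lemma injective_map {n : ℕ} (hD : ∀ m, m + 1 = n → Subsingleton (ModExt R L D m)) :
    Function.Injective (map L n f) := by
  rw [injective_iff_map_eq_zero]
  intro x hx
  cases n with
  | zero =>
    apply (zeroEquiv L A).injective
    have := zeroEquiv_map f x
    rw [hx, _root_.map_zero] at this
    ext l
    apply hf
    simpa using (LinearMap.congr_fun this l).symm
  | succ n =>
    obtain ⟨δ, -, h₂⟩ := exists_connecting L hf hg h n
    obtain ⟨y, rfl⟩ := (h₂ x).1 hx
    have := hD n rfl
    rw [Subsingleton.elim y 0, _root_.map_zero]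

lemma subsingleton_left {n : ℕ} (hB : Subsingleton (ModExt R L B n))
    (hD : ∀ m, m + 1 = n → Subsingleton (ModExt R L D m)) : Subsingleton (ModExt R L A n) :=
  (injective_map hf hg h hD).subsingleton

end Vanishing

/-- `r` annihilates `Ext(L, -)` when it annihilates `L`. -/
lemma smul_eq_zero_of_annihilates {r : R} (hr : ∀ l : L, r • l = 0) {n : ℕ} (x : ModExt R L A n) :
    r • x = 0 := by
  have h0 : r • 𝟙 (ModuleCat.of R L) = 0 := by
    ext l
    exact hr l
  have : r • x = (Abelian.Ext.mk₀ (r • 𝟙 (ModuleCat.of R L))).comp x (zero_add n) := by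
    rw [Abelian.Ext.mk₀_smul]; simp
  rw [this, h0]
  simp

lemma subsingleton_pi {ι : Type} [Finite ι] {n : ℕ} (h : Subsingleton (ModExt R L A n)) :
    Subsingleton (ModExt R L (ι → A) n) := by
  classical
  have := Fintype.ofFinite ι
  refine ⟨fun x y ↦ ?_⟩
  have key (z : ModExt R L (ι → A) n) : z = 0 := by
    have h1 : (LinearMap.id : (ι → A) →ₗ[R] (ι → A)) =
        ∑ i, LinearMap.single R (fun _ ↦ A) i ∘ₗ LinearMap.proj i := by
      ext i a j
      simp [Pi.single_apply]
    rw [← map_id_apply n z, h1, map_sum, LinearMap.sum_apply]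
    refine Finset.sum_eq_zero fun i _ ↦ ?_
    rw [map_comp_apply, Subsingleton.elim (map L n _ z) 0, _root_.map_zero]
  rw [key x, key y]

/-- `Ext` into a retract. -/
lemma injective_map_of_leftInverse {f : A →ₗ[R] B} {g : B →ₗ[R] A} (h : g ∘ₗ f = LinearMap.id)
    (n : ℕ) : Function.Injective (map L n f) := by
  refine Function.LeftInverse.injective (g := map L n g) fun x ↦ ?_
  rw [← map_comp_apply, h, map_id_apply]

end ModExt

end ExtToolkit

/-! ### Ext from the residue field, and the equality depth C = depth R. -/

noncomputable section Depth

open IsLocalRing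

variable {R : Type u} [CommRing R]

section Local

variable [IsLocalRing R]

/-- The `n`-th `Ext` of the residue field with values in `N` vanishes. -/
abbrev ResidueExtVanishes (N : Type u) [AddCommGroup N] [Module R N] (n : ℕ) : Prop :=
  Subsingleton (ModExt R (ResidueField R) N n)

lemma exists_not_residueExtVanishes [IsNoetherianRing R] (N : Type u) [AddCommGroup N] [Module R N]
    [Module.Finite R N] [Nontrivial N] : ∃ n, ¬ ResidueExtVanishes (R := R) N n := by
  by_contra! H
  have hlt : maximalIdeal R • (⊤ : Submodule R N) < ⊤ := by
    refine lt_top_iff_ne_top.2 fun h ↦ ?_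
    have := Submodule.eq_bot_of_le_smul_of_le_jacobson_bot (maximalIdeal R) (⊤ : Submodule R N)
      Module.Finite.fg_top h.ge (maximalIdeal_le_jacobson _)
    exact (bot_ne_top (α := Submodule R N)) this.symm
  have key (n : ℕ) : (n : WithBot ℕ∞) ≤ Module.supportDim R N := by
    obtain ⟨rs, hl, hm, hr⟩ := ModuleCat.exists_isRegular_of_exists_subsingleton_ext
      (maximalIdeal R) n (ModuleCat.of R N) hlt (ModuleCat.of R (ResidueField R)) (by
        change Module.support R (R ⧸ maximalIdeal R) = _
        rw [Module.support_eq_zeroLocus, Ideal.annihilator_quotient]) (fun i _ ↦ H i)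
    have := Module.supportDim_add_length_eq_supportDim_of_isRegular rs hr
    rw [hl] at this
    rw [← this]
    have : Nontrivial (N ⧸ Ideal.ofList rs • (⊤ : Submodule R N)) :=
      Submodule.Quotient.nontrivial_iff.2 hr.top_ne_smul.symm
    have h0 : 0 ≤ Module.supportDim R (N ⧸ Ideal.ofList rs • (⊤ : Submodule R N)) := by
      have : Nonempty (Module.support R (N ⧸ Ideal.ofList rs • (⊤ : Submodule R N))) :=
        (Module.nonempty_support_of_nontrivial).to_subtype
      exact Order.krullDim_nonneg
    exact le_add_of_nonneg_left h0
  have hfin : Module.supportDim R N ≤ ringKrullDim R := Module.supportDim_le_ringKrullDim R N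
  obtain ⟨d, hd⟩ : ∃ d : ℕ, ringKrullDim R = d := by
    obtain ⟨d, hd⟩ := WithBot.ne_bot_iff_exists.1 (ringKrullDim_ne_bot (R := R))
    have ht : d ≠ ⊤ := by
      rintro rfl
      exact ringKrullDim_ne_top (R := R) hd.symm
    obtain ⟨d, rfl⟩ := ENat.ne_top_iff_exists.1 ht
    exact ⟨d, hd.symm⟩
  have := (key (d + 1)).trans (hfin.trans hd.le)
  norm_cast at this
  omega

lemma ModExt.map_eq_zero_of_residueField {A B : Type u} [AddCommGroup A] [Module R A]
    [AddCommGroup B] [Module R B] (n : ℕ) {r : R} (hr : r ∈ maximalIdeal R) (f : A →ₗ[R] B) :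
    ModExt.map (ResidueField R) n (r • f) = 0 := by
  ext x
  rw [ModExt.map_smul, LinearMap.smul_apply, LinearMap.zero_apply]
  refine ModExt.smul_eq_zero_of_annihilates (fun l ↦ ?_) _
  obtain ⟨l, rfl⟩ := residue_surjective l
  rw [← residue_eq_zero_iff] at hr
  rw [Algebra.smul_def, show algebraMap R (ResidueField R) r = residue R r from rfl, hr, zero_mul]

end Local

section HomIntoC

variable (C : Type u) [AddCommGroup C] [Module R C]

variable {K K' : Type u} [AddCommGroup K] [Module R K] [AddCommGroup K'] [Module R K']
  {g : ℕ} {f : K' →ₗ[R] (Fin g → R)} {p : (Fin g → R) →ₗ[R] K}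

lemma lcomp_injective_of_surjective (hp : Function.Surjective p) :
    Function.Injective (p.lcomp R C) := by
  intro a b hab
  ext k
  obtain ⟨k, rfl⟩ := hp k
  exact LinearMap.congr_fun hab k

lemma lcomp_exact (hp : Function.Surjective p)
    (h : Function.Exact f p) : Function.Exact (p.lcomp R C) (f.lcomp R C) := by
  intro φ
  constructor
  · intro hφ
    refine ⟨p.ker.liftQ φ ?_ ∘ₗ (p.quotKerEquivOfSurjective hp).symm.toLinearMap, ?_⟩
    · intro x hx
      obtain ⟨y, rfl⟩ := (h x).1 hx
      exact LinearMap.congr_fun hφ y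
    · refine LinearMap.ext fun x ↦ ?_
      have : (p.quotKerEquivOfSurjective hp).symm (p x) = p.ker.mkQ x := by
        rw [LinearEquiv.symm_apply_eq]
        rfl
      simp only [LinearMap.lcomp_apply, LinearMap.comp_apply, LinearEquiv.coe_coe, this]
      simp
  · rintro ⟨ψ, rfl⟩
    ext x
    simp [(h (f x)).2 ⟨x, rfl⟩]

lemma lcomp_surjective (hf : Function.Injective f) (hp : Function.Surjective p)
    (h : Function.Exact f p) (hK : Subsingleton (ModExt R K C 1)) :
    Function.Surjective (f.lcomp R C) := by
  obtain ⟨δ, -, hδ⟩ := ModExt.exists_shift_one hf hp h C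
  intro φ
  obtain ⟨y, hy⟩ := (hδ φ).1 (Subsingleton.elim _ _)
  exact ⟨y, hy⟩

variable [IsLocalRing R] [IsNoetherianRing R]

omit [IsLocalRing R] in
/-- A presentation of a finite module by a finite free module, with finite kernel. -/
lemma exists_presentation (K : Type u) [AddCommGroup K] [Module R K] [Module.Finite R K] :
    ∃ (g : ℕ) (K' : Type u) (_ : AddCommGroup K') (_ : Module R K') (_ : Module.Finite R K')
      (f : K' →ₗ[R] (Fin g → R)) (p : (Fin g → R) →ₗ[R] K), Function.Injective f ∧
      Function.Surjective p ∧ Function.Exact f p := by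
  obtain ⟨g, p, hp⟩ := Module.Finite.exists_fin' R K
  exact ⟨g, LinearMap.ker p, inferInstance, inferInstance, inferInstance,
    (LinearMap.ker p).subtype, p, Subtype.val_injective, hp, LinearMap.exact_subtype_ker_map p⟩

/-- A minimal presentation of a finite module over a Noetherian local ring. -/
lemma exists_minimal_presentation (K : Type u) [AddCommGroup K] [Module R K] [Module.Finite R K] :
    ∃ (g : ℕ) (K' : Type u) (_ : AddCommGroup K') (_ : Module R K') (_ : Module.Finite R K')
      (f : K' →ₗ[R] (Fin g → R)) (p : (Fin g → R) →ₗ[R] K), Function.Injective f ∧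
      Function.Surjective p ∧ Function.Exact f p ∧ ∀ x i, f x i ∈ maximalIdeal R := by
  classical
  have hex : ∃ g, ∃ p : (Fin g → R) →ₗ[R] K, Function.Surjective p := Module.Finite.exists_fin' R K
  obtain ⟨p, hp⟩ := Nat.find_spec hex
  refine ⟨_, LinearMap.ker p, inferInstance, inferInstance, inferInstance,
    (LinearMap.ker p).subtype, p, Subtype.val_injective, hp, LinearMap.exact_subtype_ker_map p,
    fun x i ↦ ?_⟩
  by_contra hx
  rw [mem_maximalIdeal, mem_nonunits_iff, not_not] at hx
  -- `Nat.find` picks the least number of generators. A relation with a unit coordinate `x i` would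
  -- express the generator `v i` through the others, so one fewer would suffice.
  generalize hG : Nat.find hex = G at p x i
  have hmin (m : ℕ) (hm : m < G) (q : (Fin m → R) →ₗ[R] K) : ¬ Function.Surjective q :=
    fun hq ↦ Nat.find_min hex (hm.trans_eq hG.symm) ⟨q, hq⟩
  obtain ⟨x, hx0⟩ := x
  cases G with
  | zero => exact i.elim0
  | succ n =>
    let v (j : Fin (n + 1)) : K := p (Pi.single j 1)
    have hpv (y : Fin (n + 1) → R) : p y = ∑ j, y j • v j := by
      conv_lhs => rw [pi_eq_sum_univ' y]
      simp [v, map_sum]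
    let q : (Fin n → R) →ₗ[R] K := Fintype.linearCombination R (fun j ↦ v (i.succAbove j))
    have hvq (j : Fin (n + 1)) : v j ∈ LinearMap.range q := by
      have hne (j : Fin n) : v (i.succAbove j) ∈ LinearMap.range q :=
        ⟨Pi.single j 1, by simp [q]⟩
      obtain rfl | ⟨j, rfl⟩ := i.eq_self_or_eq_succAbove j
      · have h0 : ∑ j, x j • v j = 0 := by rw [← hpv]; exact hx0
        rw [Fin.sum_univ_succAbove _ j, add_eq_zero_iff_eq_neg] at h0
        obtain ⟨u, hu⟩ := hx
        have h1 : v j = u⁻¹.1 • (x j • v j) := by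
          rw [smul_smul, show x j = u from hu.symm, Units.inv_mul, one_smul]
        rw [h1, h0]
        exact Submodule.smul_mem _ _ (neg_mem (sum_mem fun l _ ↦ Submodule.smul_mem _ _ (hne l)))
      · exact hne j
    refine hmin n n.lt_succ_self q (LinearMap.range_eq_top.1 (eq_top_iff.2 fun y _ ↦ ?_))
    obtain ⟨y, rfl⟩ := hp y
    rw [hpv]
    exact sum_mem fun l _ ↦ Submodule.smul_mem _ _ (hvq l)

omit [IsLocalRing R] [IsNoetherianRing R] in
lemma subsingleton_syzygy (hf : Function.Injective f) (hp : Function.Surjective p)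
    (h : Function.Exact f p)
    (hK : ∀ i, 0 < i → Subsingleton (ModExt R K C i)) :
    ∀ i, 0 < i → Subsingleton (ModExt R K' C i) := by
  intro i hi
  obtain ⟨i, rfl⟩ := Nat.exists_eq_succ_of_ne_zero hi.ne'
  obtain ⟨e⟩ := ModExt.exists_shift_equiv hf hp h C i
  have := hK (i + 1 + 1) (by omega)
  exact e.toEquiv.subsingleton

omit [IsNoetherianRing R] in
variable {C} in
lemma residueExtVanishes_hom_free {n : ℕ} (h : ResidueExtVanishes (R := R) C n) :
    ResidueExtVanishes (R := R) ((Fin g → R) →ₗ[R] C) n := by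
  refine (ModExt.subsingleton_congr (L := ResidueField R)
    (Module.piEquiv (Fin g) R C).symm n).2 ?_
  exact ModExt.subsingleton_pi h

-- Hom(φ, C) is a combination of fixed maps whose coefficients are the matrix entries of φ. These
-- lie in 𝔪, and 𝔪 kills Ext(k, -).
omit [IsNoetherianRing R] in
lemma map_lcomp_eq_zero {g g' : ℕ} (φ : (Fin g' → R) →ₗ[R] (Fin g → R))
    (hφ : ∀ x i, φ x i ∈ maximalIdeal R) (c : ℕ) :
    ModExt.map (ResidueField R) c (φ.lcomp R C) = 0 := by
  have key : φ.lcomp R C = ∑ j, ∑ i, φ (Pi.single j 1) i •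
      (LinearMap.single R (fun _ ↦ R) i ∘ₗ LinearMap.proj j : (Fin g' → R) →ₗ[R] _).lcomp R C := by
    refine LinearMap.ext fun ψ ↦ LinearMap.pi_ext' fun l ↦ LinearMap.ext_ring ?_
    have h1 : φ (Pi.single l 1) = ∑ i, φ (Pi.single l 1) i • Pi.single i (1 : R) := by
      ext m
      simp [Finset.sum_apply, Pi.single_apply]
    have h2 : ψ (φ (Pi.single l 1)) = ∑ i, φ (Pi.single l 1) i • ψ (Pi.single i 1) := by
      conv_lhs => rw [h1]
      simp [map_sum]
    simp only [LinearMap.comp_apply, LinearMap.lcomp_apply, LinearMap.sum_apply,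
      LinearMap.smul_apply, LinearMap.single_apply, LinearMap.proj_apply]
    rw [h2, Finset.sum_eq_single l]
    · simp
    · intro j _ hj
      simp [hj]
    · simp
  rw [key, ModExt.map_sum]
  refine Finset.sum_eq_zero fun j _ ↦ ?_
  rw [ModExt.map_sum]
  exact Finset.sum_eq_zero fun i _ ↦ ModExt.map_eq_zero_of_residueField c (hφ _ _) _

/-- As Ext¹(K, C) = 0, a presentation gives an exact sequence 0 → Hom(K, C) → C^g → Hom(K', C) → 0,
and the syzygy K' inherits the Ext-vanishing. Each degree j thus reduces to degree j - 1 for K'. -/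
lemma residueExtVanishes_hom {c : ℕ} (hC : ∀ j < c, ResidueExtVanishes (R := R) C j) :
    ∀ j < c, ∀ (K : Type u) [AddCommGroup K] [Module R K] [Module.Finite R K],
    (∀ i, 0 < i → Subsingleton (ModExt R K C i)) → ResidueExtVanishes (R := R) (K →ₗ[R] C) j := by
  intro j
  induction j with
  | zero =>
    intro hj K _ _ _ hK
    obtain ⟨g, K', _, _, _, f, p, hf, hp, h⟩ := exists_presentation (R := R) K
    exact ModExt.subsingleton_left (lcomp_injective_of_surjective C hp)
      (lcomp_surjective C hf hp h (hK 1 one_pos)) (lcomp_exact C hp h)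
      (residueExtVanishes_hom_free (hC 0 hj)) (by simp)
  | succ j ih =>
    intro hj K _ _ _ hK
    obtain ⟨g, K', _, _, _, f, p, hf, hp, h⟩ := exists_presentation (R := R) K
    refine ModExt.subsingleton_left (lcomp_injective_of_surjective C hp)
      (lcomp_surjective C hf hp h (hK 1 one_pos)) (lcomp_exact C hp h)
      (residueExtVanishes_hom_free (hC _ hj)) fun m hm ↦ ?_
    obtain rfl : m = j := by omega
    exact ih (by omega) K' (subsingleton_syzygy C hf hp h hK)

/-- For a minimal presentation the composite C^g → Hom(K', C) → C^g' has entries in 𝔪, so it is zero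
on Ext^c(k, -). The second map is injective there, since depth Hom(K₂, C) ≥ c. Hence the first is
zero, and Ext^c(k, Hom(K, C)) surjects onto Ext^c(k, C^g) ≠ 0. -/
lemma not_residueExtVanishes_hom {c : ℕ} (hC : ∀ j < c, ResidueExtVanishes (R := R) C j)
    (hc : ¬ ResidueExtVanishes (R := R) C c) (K : Type u) [AddCommGroup K] [Module R K]
    [Module.Finite R K] [Nontrivial K] (hK : ∀ i, 0 < i → Subsingleton (ModExt R K C i)) :
    ¬ ResidueExtVanishes (R := R) (K →ₗ[R] C) c := by
  intro H
  obtain ⟨g, K', _, _, _, f, p, hf, hp, h, hmin⟩ := exists_minimal_presentation (R := R) K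
  obtain ⟨g', K₂, _, _, _, f', p', hf', hp', h'⟩ := exists_presentation (R := R) K'
  have hK' := subsingleton_syzygy C hf hp h hK
  have hinj : Function.Injective (ModExt.map (ResidueField R) c (p'.lcomp R C)) :=
    ModExt.injective_map (lcomp_injective_of_surjective C hp')
      (lcomp_surjective C hf' hp' h' (hK' 1 one_pos)) (lcomp_exact C hp' h') fun m hm ↦
        residueExtVanishes_hom C hC m (by omega) K₂ (subsingleton_syzygy C hf' hp' h' hK')
  have hex := ModExt.exact_map (ResidueField R) (lcomp_injective_of_surjective C hp)
      (lcomp_surjective C hf hp h (hK 1 one_pos)) (lcomp_exact C hp h) c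
  have hzero : ModExt.map (ResidueField R) c (p'.lcomp R C ∘ₗ f.lcomp R C) = 0 :=
    map_lcomp_eq_zero C (f ∘ₗ p') (fun x i ↦ hmin _ i) c
  have hg : g ≠ 0 := by
    rintro rfl
    have := hp.subsingleton
    exact not_subsingleton K this
  have hall : Subsingleton (ModExt R (ResidueField R) ((Fin g → R) →ₗ[R] C) c) := by
    refine subsingleton_of_forall_eq 0 fun x ↦ ?_
    obtain ⟨y, rfl⟩ := (hex x).1 <| hinj <| by
      rw [← ModExt.map_comp_apply, hzero, map_zero, LinearMap.zero_apply]
    rw [Subsingleton.elim y 0, map_zero]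
  apply hc
  obtain ⟨g, rfl⟩ := Nat.exists_eq_succ_of_ne_zero hg
  rw [ModExt.subsingleton_congr (Module.piEquiv (Fin (g + 1)) R C).symm] at hall
  exact (ModExt.injective_map_of_leftInverse (L := ResidueField R)
    (f := LinearMap.single R (fun _ ↦ C) (0 : Fin (g + 1)))
    (g := LinearMap.proj 0) (by ext; simp) c).subsingleton

omit [IsNoetherianRing R] in
variable {C} in
lemma IsSemidualizing.nontrivial (hC : IsSemidualizing R C) : Nontrivial C := by
  by_contra h
  rw [not_nontrivial_iff_subsingleton] at h
  exact zero_ne_one (hC.homothety_bijective.1 (Subsingleton.elim (LinearMap.lsmul R C 0) _))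

variable {C} in
lemma IsSemidualizing.exists_depth (hC : IsSemidualizing R C) :
    ∃ c, (∀ j < c, ResidueExtVanishes (R := R) C j) ∧ ¬ ResidueExtVanishes (R := R) C c ∧
      (∀ j < c, ResidueExtVanishes (R := R) R j) ∧ ¬ ResidueExtVanishes (R := R) R c := by
  classical
  have := hC.finite
  have := hC.nontrivial
  have hex := exists_not_residueExtVanishes (R := R) C
  let e : R ≃ₗ[R] (C →ₗ[R] C) := LinearEquiv.ofBijective (LinearMap.lsmul R C)
    hC.homothety_bijective
  have hlt : ∀ j < Nat.find hex, ResidueExtVanishes (R := R) C j := fun j hj ↦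
    not_not.1 (Nat.find_min hex hj)
  refine ⟨Nat.find hex, hlt, Nat.find_spec hex, fun j hj ↦ ?_, fun h ↦ ?_⟩
  · exact (ModExt.subsingleton_congr e j).2 (residueExtVanishes_hom C hlt j hj C hC.ext_vanishing)
  · exact not_residueExtVanishes_hom C hlt (Nat.find_spec hex) C hC.ext_vanishing
      ((ModExt.subsingleton_congr e _).1 h)

end HomIntoC

lemma localDepth_eq [IsLocalRing R] {N : Type u} [AddCommGroup N] [Module R N] {c : ℕ}
    (h : ∀ j < c, ResidueExtVanishes (R := R) N j) (hc : ¬ ResidueExtVanishes (R := R) N c) :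
    localDepth R N = (c : EReal) := by
  refine le_antisymm (iInf₂_le c (not_subsingleton_iff_nontrivial.1 hc)) ?_
  refine le_iInf₂ fun i hi ↦ ?_
  have : c ≤ i := by
    by_contra! hlt
    exact not_subsingleton_iff_nontrivial.2 hi (h i hlt)
  exact_mod_cast this

end Depth

/-! ### Projective modules of arbitrary rank over a Noetherian local ring. -/

noncomputable section ProjectiveModules

open IsLocalRing TensorProduct

variable {R : Type u} [CommRing R]

section Coevaluation

variable {C P Q : Type u} [AddCommGroup C] [Module R C] [AddCommGroup P] [Module R P]
  [AddCommGroup Q] [Module R Q]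

/-- A linear map from a finite module to `ι →₀ A` has values supported in a common finite set. -/
lemma LinearMap.exists_finset_support {ι : Type*} {L A : Type*} [AddCommGroup L] [Module R L]
    [AddCommGroup A] [Module R A] [Module.Finite R L] (φ : L →ₗ[R] (ι →₀ A)) :
    ∃ S : Finset ι, ∀ l, ∀ i ∉ S, φ l i = 0 := by
  classical
  obtain ⟨t, ht⟩ := Module.Finite.fg_top (R := R) (M := L)
  refine ⟨t.biUnion fun l ↦ (φ l).support, fun l i hi ↦ ?_⟩
  have : (⊤ : Submodule R L) ≤ LinearMap.ker (Finsupp.lapply i ∘ₗ φ) := by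
    rw [← ht, Submodule.span_le]
    intro l hl
    by_contra h
    exact hi (Finset.mem_biUnion.2 ⟨l, hl, Finsupp.mem_support_iff.2 h⟩)
  exact this (Submodule.mem_top (x := l))

/-- In each coordinate this is the homothety isomorphism. Finite generation of C makes the
coordinates of a map C → C^(ι) vanish outside one finite set, which gives surjectivity. -/
lemma IsSemidualizing.mk_bijective_finsupp (hC : IsSemidualizing R C) (ι : Type u) :
    Function.Bijective (TensorProduct.mk R (ι →₀ R) C) := by
  classical
  have := hC.finite
  let e := TensorProduct.finsuppScalarLeft R C ι
  have he (q : ι →₀ R) (c : C) (i : ι) : e (q ⊗ₜ c) i = q i • c := by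
    simp [e, TensorProduct.finsuppScalarLeft_apply_tmul_apply]
  constructor
  · rw [injective_iff_map_eq_zero]
    intro q hq
    ext i
    apply hC.homothety_bijective.1
    ext c
    have := LinearMap.congr_fun hq c
    simp only [LinearMap.lsmul_apply, ← he, Finsupp.coe_zero, Pi.zero_apply, zero_smul]
    rw [show q ⊗ₜ[R] c = 0 from this]
    simp
  · intro φ
    let ψ : C →ₗ[R] (ι →₀ C) := e.toLinearMap ∘ₗ φ
    obtain ⟨S, hS⟩ := ψ.exists_finset_support
    choose r hr using fun i ↦ hC.homothety_bijective.2 (Finsupp.lapply i ∘ₗ ψ)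
    refine ⟨Finsupp.onFinset S r fun i hi ↦ ?_, ?_⟩
    · by_contra hiS
      apply hi
      apply hC.homothety_bijective.1
      rw [hr]
      ext c
      simpa using hS c i hiS
    · ext c
      apply e.injective
      ext i
      rw [TensorProduct.mk_apply, he]
      exact LinearMap.congr_fun (hr i) c

lemma IsSemidualizing.mk_bijective (hC : IsSemidualizing R C) [Module.Projective R P] :
    Function.Bijective (TensorProduct.mk R P C) := by
  obtain ⟨s, hs⟩ := Module.projective_def'.1 (inferInstance : Module.Projective R P)
  set p := Finsupp.linearCombination R (id : P → P)
  have hb := hC.mk_bijective_finsupp P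
  constructor
  · rw [injective_iff_map_eq_zero]
    intro x hx
    have : s x = 0 := by
      apply hb.1
      ext c
      have := congrArg (s.rTensor C) (LinearMap.congr_fun hx c)
      simpa using this
    simpa [this] using (LinearMap.congr_fun hs x).symm
  · intro φ
    obtain ⟨q, hq⟩ := hb.2 (s.rTensor C ∘ₗ φ)
    refine ⟨p q, ?_⟩
    ext c
    have := congrArg (p.rTensor C) (LinearMap.congr_fun hq c)
    simp only [TensorProduct.mk_apply, LinearMap.rTensor_tmul, LinearMap.comp_apply] at this ⊢
    rw [this, ← LinearMap.comp_apply, ← LinearMap.rTensor_comp, hs]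
    simp

end Coevaluation

section ExtSums

variable [IsNoetherianRing R]

/-- The key case is n = 1: a map from the finite first syzygy to A^(ι) involves finitely many
coordinates, each of which extends to the free module. Degree 0 is coordinatewise, and higher
degrees follow by dimension shifting. -/
lemma ModExt.subsingleton_finsupp (ι : Type u) {A : Type u} [AddCommGroup A] [Module R A] (n : ℕ) :
    ∀ (L : Type u) [AddCommGroup L] [Module R L] [Module.Finite R L],
      Subsingleton (ModExt R L A n) → Subsingleton (ModExt R L (ι →₀ A) n) := by
  classical
  obtain _ | n := n
  · intro L _ _ _ h
    rw [(ModExt.zeroEquiv L A).toEquiv.subsingleton_congr] at h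
    rw [(ModExt.zeroEquiv L (ι →₀ A)).toEquiv.subsingleton_congr]
    refine subsingleton_of_forall_eq 0 fun φ ↦ ?_
    ext l i
    exact LinearMap.congr_fun (Subsingleton.elim (Finsupp.lapply i ∘ₗ φ) 0) l
  induction n with
  | zero =>
    intro L _ _ _ h
    obtain ⟨g, L', _, _, _, f, p, hf, hp, hfp⟩ := exists_presentation (R := R) L
    obtain ⟨δ, hδ, hδ'⟩ := ModExt.exists_shift_one hf hp hfp (ι →₀ A)
    obtain ⟨δ₀, -, hδ₀⟩ := ModExt.exists_shift_one hf hp hfp A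
    refine subsingleton_of_forall_eq 0 fun x ↦ ?_
    obtain ⟨φ, rfl⟩ := hδ x
    rw [hδ']
    obtain ⟨S, hS⟩ := φ.exists_finset_support
    choose y hy using fun i ↦ (hδ₀ (Finsupp.lapply i ∘ₗ φ)).1 (Subsingleton.elim _ _)
    refine ⟨∑ i ∈ S, Finsupp.lsingle i ∘ₗ y i, ?_⟩
    ext l i
    have h1 : y i (f l) = φ l i := LinearMap.congr_fun (hy i) l
    simp only [LinearMap.comp_apply, LinearMap.sum_apply, Finsupp.lsingle_apply,
      Finsupp.finsetSum_apply, Finsupp.single_apply, Finset.sum_ite_eq', h1]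
    split_ifs with hi
    · rfl
    · exact (hS l i hi).symm
  | succ n ih =>
    intro L _ _ _ h
    obtain ⟨g, L', _, _, _, f, p, hf, hp, hfp⟩ := exists_presentation (R := R) L
    obtain ⟨e⟩ := ModExt.exists_shift_equiv hf hp hfp A n
    obtain ⟨e'⟩ := ModExt.exists_shift_equiv hf hp hfp (ι →₀ A) n
    exact e'.toEquiv.subsingleton_congr.1 (ih L' (e.toEquiv.subsingleton_congr.2 h))

lemma ModExt.subsingleton_tensor {L A P : Type u} [AddCommGroup L] [Module R L]
    [Module.Finite R L] [AddCommGroup A] [Module R A] [AddCommGroup P] [Module R P]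
    [Module.Projective R P] {n : ℕ} (h : Subsingleton (ModExt R L A n)) :
    Subsingleton (ModExt R L (P ⊗[R] A) n) := by
  classical
  obtain ⟨s, hs⟩ := Module.projective_def'.1 (inferInstance : Module.Projective R P)
  have h1 := (ModExt.subsingleton_congr (L := L)
    (A := (P →₀ R) ⊗[R] A) (B := P →₀ A) (TensorProduct.finsuppScalarLeft R A P) n).2 (ModExt.subsingleton_finsupp P n L h)
  exact (ModExt.injective_map_of_leftInverse (L := L) (A := P ⊗[R] A) (B := (P →₀ R) ⊗[R] A) (f := s.rTensor A)
    (g := (Finsupp.linearCombination R (id : P → P)).rTensor A)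
    (by rw [← LinearMap.rTensor_comp, hs, LinearMap.rTensor_id]) n).subsingleton

end ExtSums

section Local

variable [IsLocalRing R]

variable {P : Type u} [AddCommGroup P] [Module R P]

/-- The coordinates of x under a section into a free module write x as a combination of elements of
P. If all were non-units, x would lie in 𝔪P. -/
lemma Module.Projective.exists_isUnit_apply [Module.Projective R P] {x : P}
    (hx : x ∉ maximalIdeal R • (⊤ : Submodule R P)) : ∃ f : P →ₗ[R] R, IsUnit (f x) := by
  obtain ⟨s, hs⟩ := Module.projective_def'.1 (inferInstance : Module.Projective R P)
  by_contra! h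
  apply hx
  have h1 : x = Finsupp.linearCombination R id (s x) := (LinearMap.congr_fun hs x).symm
  rw [h1, Finsupp.linearCombination_apply]
  refine Submodule.sum_mem _ fun p _ ↦ Submodule.smul_mem_smul ?_ Submodule.mem_top
  exact h (Finsupp.lapply p ∘ₗ s)

/-- Nakayama without finite generation. If P = 𝔪P, every functional on P takes values in 𝔪, so the
finitely generated ideal I of coordinates of x satisfies I ⊆ 𝔪I. Ordinary Nakayama gives I = 0. -/
lemma Module.Projective.eq_zero_of_forall_mem_smul [Module.Projective R P]
    (h : ∀ x : P, x ∈ maximalIdeal R • (⊤ : Submodule R P)) (x : P) : x = 0 := by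
  classical
  obtain ⟨s, hs⟩ := Module.projective_def'.1 (inferInstance : Module.Projective R P)
  have hm (f : P →ₗ[R] R) (x : P) : f x ∈ maximalIdeal R := by
    have hle : maximalIdeal R • (⊤ : Submodule R P) ≤ Submodule.comap f (maximalIdeal R) := by
      refine Submodule.smul_le.2 fun r hr y _ ↦ ?_
      rw [Submodule.mem_comap, LinearMap.map_smul, smul_eq_mul]
      exact Ideal.mul_mem_right _ _ hr
    exact hle (h x)
  have h1 : x = Finsupp.linearCombination R id (s x) := (LinearMap.congr_fun hs x).symm
  let I : Ideal R := Ideal.span ((s x).support.image (s x) : Finset R)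
  have hI (p : P) : s x p ∈ I := by
    by_cases hp : p ∈ (s x).support
    · exact Ideal.subset_span (Finset.mem_coe.2 (Finset.mem_image_of_mem _ hp))
    · rw [Finsupp.notMem_support_iff.1 hp]; exact I.zero_mem
  have hle : I ≤ maximalIdeal R • I := by
    refine Ideal.span_le.2 fun r hr ↦ ?_
    obtain ⟨q, -, rfl⟩ := Finset.mem_image.1 (Finset.mem_coe.1 hr)
    have h2 : s x q = ∑ p ∈ (s x).support, s p q * s x p := by
      conv_lhs => rw [h1]
      rw [Finsupp.linearCombination_apply, Finsupp.sum, map_sum, Finsupp.finsetSum_apply]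
      refine Finset.sum_congr rfl fun p _ ↦ ?_
      simp [mul_comm]
    rw [h2]
    exact sum_mem fun p _ ↦ Submodule.smul_mem_smul (hm (Finsupp.lapply q ∘ₗ s) p) (hI p)
  have hbot : I = ⊥ := Submodule.eq_bot_of_le_smul_of_le_jacobson_bot _ _ ⟨_, rfl⟩ hle
    (maximalIdeal_le_jacobson _)
  have h0 : s x = 0 := by
    ext p
    have := hI p
    rw [hbot] at this
    exact this
  rw [h1, h0, map_zero]

lemma Module.Projective.nontrivial_tensor [Module.Projective R P] [Nontrivial P] (C : Type u)
    [AddCommGroup C] [Module R C] [Nontrivial C] : Nontrivial (P ⊗[R] C) := by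
  obtain ⟨x, hx⟩ : ∃ x : P, x ∉ maximalIdeal R • (⊤ : Submodule R P) := by
    by_contra! h
    obtain ⟨y, hy⟩ := exists_ne (0 : P)
    exact hy (Module.Projective.eq_zero_of_forall_mem_smul h y)
  obtain ⟨f, hf⟩ := Module.Projective.exists_isUnit_apply hx
  obtain ⟨c, hc⟩ := exists_ne (0 : C)
  refine ⟨x ⊗ₜ c, 0, fun h ↦ hc ?_⟩
  have := congrArg (TensorProduct.lid R C ∘ f.rTensor C) h
  simpa [hf.smul_eq_zero] using this

end Local

section StablyFinite

/-- Modules that become finite up to projective summands. -/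
def IsStablyFinite (R : Type u) [CommRing R] (W : Type u) [AddCommGroup W] [Module R W] : Prop :=
  ∃ (Q Q' : Type u) (_ : AddCommGroup Q) (_ : Module R Q) (_ : AddCommGroup Q') (_ : Module R Q')
    (π : (W × Q) →ₗ[R] Q'), Module.Projective R Q ∧ Module.Projective R Q' ∧
      Function.Surjective π ∧ Module.Finite R (LinearMap.ker π)

variable {A B D : Type u} [AddCommGroup A] [Module R A] [AddCommGroup B] [Module R B]
  [AddCommGroup D] [Module R D] {f : A →ₗ[R] B} {g : B →ₗ[R] D}

lemma IsStablyFinite.of_subsingleton [Subsingleton A] : IsStablyFinite R A := by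
  refine ⟨PUnit, PUnit, inferInstance, inferInstance, inferInstance, inferInstance, 0,
    inferInstance, inferInstance, fun x ↦ ⟨0, rfl⟩, inferInstance⟩

variable [IsNoetherianRing R]

lemma Module.Finite.of_exact_of_isNoetherianRing {A B D : Type*} [AddCommGroup A] [Module R A] [AddCommGroup B]
    [Module R B] [AddCommGroup D] [Module R D] {f : A →ₗ[R] B} {g : B →ₗ[R] D}
    (h : Function.Exact f g) (hA : Module.Finite R A) (hD : Module.Finite R D) :
    Module.Finite R B := by
  have := isNoetherian_of_range_eq_ker f g h.linearMap_ker_eq.symm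
  infer_instance

/-- Pulling π back along B ⊕ Q → D ⊕ Q makes the new kernel an extension of the finite module ker π
by a quotient of A. -/
lemma IsStablyFinite.of_extension (h : Function.Exact f g) (hg : Function.Surjective g)
    (hA : Module.Finite R A) (hD : IsStablyFinite R D) : IsStablyFinite R B := by
  obtain ⟨Q, Q', _, _, _, _, π, hQ, hQ', hπ, hfin⟩ := hD
  refine ⟨Q, Q', inferInstance, inferInstance, inferInstance, inferInstance,
    π ∘ₗ LinearMap.prodMap g LinearMap.id, hQ, hQ', hπ.comp (hg.prodMap Function.surjective_id), ?_⟩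
  let G : LinearMap.ker (π ∘ₗ LinearMap.prodMap g LinearMap.id) →ₗ[R] LinearMap.ker π :=
    (LinearMap.prodMap g LinearMap.id).restrict fun x hx ↦ hx
  let F : A →ₗ[R] LinearMap.ker (π ∘ₗ LinearMap.prodMap g LinearMap.id) :=
    (LinearMap.inl R B Q ∘ₗ f).codRestrict _ fun a ↦ by
      change π (g (f a), 0) = 0
      rw [h.apply_apply_eq_zero a]
      exact map_zero π
  refine Module.Finite.of_exact_of_isNoetherianRing (f := F) (g := G) (fun x ↦ ?_) hA hfin
  obtain ⟨⟨b, q⟩, hx⟩ := x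
  constructor
  · intro hx0
    have h2 : (g b, q) = 0 := congrArg Subtype.val hx0
    obtain ⟨h2, h3⟩ := Prod.ext_iff.1 h2
    obtain ⟨a, ha⟩ := (h b).1 h2
    exact ⟨a, Subtype.ext (Prod.ext ha h3.symm)⟩
  · rintro ⟨a, ha⟩
    rw [← ha]
    exact Subtype.ext (Prod.ext (h.apply_apply_eq_zero a) rfl)

/-- A Schanuel-type argument. Pulling back to B ⊕ Q gives an exact sequence 0 → A → E → ker π → 0
with E = ker ρ projective. Lifting a free cover R^n → ker π to E yields a surjection A ⊕ R^n → E
whose kernel embeds in R^n. -/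
lemma IsStablyFinite.syzygy [Module.Projective R B] (hf : Function.Injective f)
    (h : Function.Exact f g) (hg : Function.Surjective g)
    (hD : IsStablyFinite R D) : IsStablyFinite R A := by
  obtain ⟨Q, Q', _, _, _, _, π, hQ, hQ', hπ, hfin⟩ := hD
  let ρ : (B × Q) →ₗ[R] Q' := π ∘ₗ LinearMap.prodMap g LinearMap.id
  have hρ : Function.Surjective ρ := hπ.comp (hg.prodMap Function.surjective_id)
  obtain ⟨σ, hσ⟩ := Module.projective_lifting_property ρ LinearMap.id hρ
  have hE : Module.Projective R (LinearMap.ker ρ) := by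
    refine Module.Projective.of_split (LinearMap.ker ρ).subtype
      ((LinearMap.id - σ ∘ₗ ρ).codRestrict _ fun x ↦ ?_) (LinearMap.ext fun x ↦ Subtype.ext ?_)
    · simp
    · change ρ (x - σ (ρ x)) = 0
      rw [map_sub, sub_eq_zero]
      exact (LinearMap.congr_fun hσ (ρ x)).symm
  obtain ⟨n, p, hp⟩ := Module.Finite.exists_fin' R (LinearMap.ker π)
  let G : LinearMap.ker ρ →ₗ[R] LinearMap.ker π :=
    (LinearMap.prodMap g LinearMap.id).restrict fun x hx ↦ hx
  have hG : Function.Surjective G := by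
    rintro ⟨x, hx⟩
    obtain ⟨y, rfl⟩ := hg.prodMap Function.surjective_id x
    exact ⟨⟨y, hx⟩, rfl⟩
  obtain ⟨l, hl⟩ := Module.projective_lifting_property G p hG
  let F : A →ₗ[R] LinearMap.ker ρ := (LinearMap.inl R B Q ∘ₗ f).codRestrict _ fun a ↦ by
    change π (g (f a), 0) = 0
    rw [h.apply_apply_eq_zero a]
    exact map_zero π
  have hF : Function.Injective F := by
    intro a b hab
    apply hf
    exact congrArg (fun z : LinearMap.ker ρ ↦ z.1.1) hab
  have hFG (x) (hx : G x = 0) : ∃ a, F a = x := by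
    obtain ⟨⟨b, q⟩, hx'⟩ := x
    have h2 : (g b, q) = 0 := congrArg Subtype.val hx
    rw [Prod.ext_iff] at h2
    obtain ⟨a, ha⟩ := (h b).1 h2.1
    refine ⟨a, Subtype.ext (Prod.ext ha h2.2.symm)⟩
  have hGF (a) : G (F a) = 0 := Subtype.ext (Prod.ext (h.apply_apply_eq_zero a) rfl)
  refine ⟨ULift.{u} (Fin n → R), LinearMap.ker ρ, inferInstance, inferInstance, inferInstance,
    inferInstance, LinearMap.coprod F (l ∘ₗ ULift.moduleEquiv.toLinearMap), ?_, hE, ?_, ?_⟩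
  · exact Module.Projective.of_equiv ULift.moduleEquiv.symm
  · intro e
    obtain ⟨r, hr⟩ := hp (G e)
    obtain ⟨a, ha⟩ := hFG (e - l r) (by
      rw [map_sub, ← hr, ← hl]
      simp)
    exact ⟨(a, ⟨r⟩), by simp [ha]⟩
  · have hinj : Function.Injective (LinearMap.snd R A (ULift.{u} (Fin n → R)) ∘ₗ
        (LinearMap.ker (LinearMap.coprod F (l ∘ₗ ULift.moduleEquiv.toLinearMap))).subtype) := by
      rw [injective_iff_map_eq_zero]
      rintro ⟨⟨a, r⟩, hx⟩ h0
      obtain rfl : r = 0 := h0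
      have : F a = 0 := by simpa using hx
      obtain rfl := hF (this.trans (map_zero F).symm)
      rfl
    exact Module.Finite.of_injective _ hinj

variable [IsLocalRing R]

/-- Injectivity of `𝔪 ⊗ A → A`, that is, vanishing of `Tor₁(k, A)`. -/
def TorResidueVanishes (R : Type u) [CommRing R] [IsLocalRing R] (A : Type u) [AddCommGroup A]
    [Module R A] : Prop :=
  Function.Injective ((maximalIdeal R).subtype.rTensor A)

omit [IsNoetherianRing R]

lemma TorResidueVanishes.of_leftInverse {i : A →ₗ[R] B} {p : B →ₗ[R] A}
    (h : p ∘ₗ i = LinearMap.id) (hB : TorResidueVanishes R B) : TorResidueVanishes R A := by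
  rw [TorResidueVanishes, injective_iff_map_eq_zero]
  intro x hx
  have h1 : i.lTensor (maximalIdeal R) x = 0 := by
    apply hB
    rw [← LinearMap.comp_apply, LinearMap.rTensor_comp_lTensor, ← LinearMap.lTensor_comp_rTensor,
      LinearMap.comp_apply, hx, map_zero, map_zero]
  have h2 := congrArg (p.lTensor (maximalIdeal R)) h1
  rwa [← LinearMap.comp_apply, ← LinearMap.lTensor_comp, h, LinearMap.lTensor_id, map_zero] at h2

lemma TorResidueVanishes.prod (hA : TorResidueVanishes R A) (hB : TorResidueVanishes R B) :
    TorResidueVanishes R (A × B) := by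
  rw [TorResidueVanishes, injective_iff_map_eq_zero]
  intro x hx
  have key {D : Type u} [AddCommGroup D] [Module R D] (hD : TorResidueVanishes R D)
      (p : (A × B) →ₗ[R] D) : p.lTensor (maximalIdeal R) x = 0 := by
    apply hD
    rw [← LinearMap.comp_apply, LinearMap.rTensor_comp_lTensor, ← LinearMap.lTensor_comp_rTensor,
      LinearMap.comp_apply, hx, map_zero, map_zero]
  have hid : (LinearMap.id : (A × B) →ₗ[R] (A × B)) =
      LinearMap.inl R A B ∘ₗ LinearMap.fst R A B + LinearMap.inr R A B ∘ₗ LinearMap.snd R A B := by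
    ext <;> simp
  have h1 : (LinearMap.id : (A × B) →ₗ[R] (A × B)).lTensor (maximalIdeal R) x = 0 := by
    rw [hid, LinearMap.lTensor_add, LinearMap.lTensor_comp, LinearMap.lTensor_comp,
      LinearMap.add_apply, LinearMap.comp_apply, LinearMap.comp_apply, key hA, key hB]
    simp
  simpa using h1

lemma TorResidueVanishes.of_projective [Module.Projective R A] : TorResidueVanishes R A :=
  Module.Flat.rTensor_preserves_injective_linearMap _ Subtype.val_injective

/-- The condition `hmin` says that k ⊗ f is injective. Comparing the presentation with 0 → 𝔪 → R → k
→ 0, where B is flat, carries this over to 𝔪 ⊗ D → D; f itself need not be injective. -/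
lemma TorResidueVanishes.of_presentation [Module.Projective R B] (h : Function.Exact f g)
    (hg : Function.Surjective g)
    (hmin : ∀ x, f x ∈ maximalIdeal R • (⊤ : Submodule R B) →
      x ∈ maximalIdeal R • (⊤ : Submodule R A)) : TorResidueVanishes R D := by
  rw [TorResidueVanishes, ← LinearMap.lTensor_inj_iff_rTensor_inj]
  have hf : Function.Injective (f.lTensor (ResidueField R)) := by
    rw [injective_iff_map_eq_zero]
    intro x hx
    obtain ⟨a, rfl⟩ := TensorProduct.mk_surjective R A (ResidueField R) residue_surjective x
    have hk (E : Type u) [AddCommGroup E] [Module R E] (e : E) :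
        (1 : ResidueField R) ⊗ₜ[R] e = 0 ↔ e ∈ maximalIdeal R • (⊤ : Submodule R E) := by
      rw [← LinearMap.ker_tensorProductMk]
      rfl
    rw [TensorProduct.mk_apply, hk]
    rw [TensorProduct.mk_apply, LinearMap.lTensor_tmul, hk] at hx
    exact hmin a hx
  exact lTensor_injective_of_exact_of_exact_of_rTensor_injective
    h hg (LinearMap.exact_subtype_mkQ (maximalIdeal R)) (Submodule.mkQ_surjective _)
    ((LinearMap.lTensor_inj_iff_rTensor_inj _ _).mp hf)
    (Module.Flat.lTensor_preserves_injective_linearMap _ Subtype.val_injective)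

/-- Since π splits, A ⊕ Q ≅ ker π ⊕ Q'. The finite module ker π inherits the vanishing of Tor₁(k, -)
as a retract, hence is free, and A is a summand of a projective module. -/
lemma IsStablyFinite.projective [IsNoetherianRing R] (hA : IsStablyFinite R A)
    (h : TorResidueVanishes R A) : Module.Projective R A := by
  obtain ⟨Q, Q', _, _, _, _, π, hQ, hQ', hπ, hfin⟩ := hA
  obtain ⟨σ, hσ⟩ := Module.projective_lifting_property π LinearMap.id hπ
  have hσ' (y) : π (σ y) = y := LinearMap.congr_fun hσ y
  let ρ : (A × Q) →ₗ[R] LinearMap.ker π :=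
    (LinearMap.id - σ ∘ₗ π).codRestrict _ fun x ↦ by
      change π (x - σ (π x)) = 0
      rw [map_sub, hσ', sub_self]
  have hρ : ρ ∘ₗ (LinearMap.ker π).subtype = LinearMap.id :=
    LinearMap.ext fun x ↦ Subtype.ext (by simp [ρ])
  have hN : TorResidueVanishes R (LinearMap.ker π) := (h.prod .of_projective).of_leftInverse hρ
  have : Module.FinitePresentation R (LinearMap.ker π) :=
    Module.finitePresentation_of_finite R _
  have : Module.Free R (LinearMap.ker π) := Module.free_of_maximalIdeal_rTensor_injective hN
  have : Module.Projective R (A × Q) :=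
    Module.Projective.of_split (ρ.prod π) ((LinearMap.ker π).subtype.coprod σ)
      (LinearMap.ext fun x ↦ by simp [ρ])
  exact Module.Projective.of_split (LinearMap.inl R A Q) (LinearMap.fst R A Q)
    (LinearMap.fst_comp_inl R A Q)

/-- A map of projective modules over a local ring which is injective modulo the maximal ideal and
whose cokernel is projective splits. -/
lemma exists_leftInverse_of_projective_coker [Module.Projective R A] [Module.Projective R B]
    [Module.Projective R D] (h : Function.Exact f g) (hg : Function.Surjective g)
    (hmin : ∀ x, f x ∈ maximalIdeal R • (⊤ : Submodule R B) →
      x ∈ maximalIdeal R • (⊤ : Submodule R A)) : ∃ r : B →ₗ[R] A, r ∘ₗ f = LinearMap.id := by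
  obtain ⟨σ, hσ⟩ := Module.projective_lifting_property g LinearMap.id hg
  have hσ' (y) : g (σ y) = y := LinearMap.congr_fun hσ y
  let ρ : B →ₗ[R] LinearMap.range f :=
    (LinearMap.id - σ ∘ₗ g).codRestrict _ fun x ↦ by
      apply (h _).1
      change g (x - σ (g x)) = 0
      rw [map_sub, hσ', sub_self]
  have hρf (a : A) : ρ (f a) = f.rangeRestrict a := Subtype.ext (by
    change f a - σ (g (f a)) = f a
    rw [h.apply_apply_eq_zero a, map_zero, sub_zero])
  have : Module.Projective R (LinearMap.range f) := by
    refine Module.Projective.of_split (LinearMap.range f).subtype ρ (LinearMap.ext fun x ↦ ?_)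
    obtain ⟨_, ⟨a, rfl⟩⟩ := x
    exact hρf a
  obtain ⟨τ, hτ⟩ := Module.projective_lifting_property f.rangeRestrict LinearMap.id
    f.surjective_rangeRestrict
  have hτ' (y) : f.rangeRestrict (τ y) = y := LinearMap.congr_fun hτ y
  let κ : A →ₗ[R] LinearMap.ker f :=
    (LinearMap.id - τ ∘ₗ f.rangeRestrict).codRestrict _ fun x ↦ by
      have : f (τ (f.rangeRestrict x)) = f x := congrArg Subtype.val (hτ' (f.rangeRestrict x))
      change f (x - τ (f.rangeRestrict x)) = 0
      rw [map_sub, this, sub_self]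
  have hκ (x : LinearMap.ker f) : κ x = x := Subtype.ext (by
    have : f.rangeRestrict x.1 = 0 := Subtype.ext x.2
    simp [κ, this])
  have : Module.Projective R (LinearMap.ker f) :=
    Module.Projective.of_split (LinearMap.ker f).subtype κ (LinearMap.ext hκ)
  -- By `hmin` the kernel lies in 𝔪A. As a direct summand of A it then equals 𝔪 times itself, so
  -- Nakayama for projectives applies.
  have hker (x : LinearMap.ker f) : x = 0 := by
    refine Module.Projective.eq_zero_of_forall_mem_smul (R := R) (fun y ↦ ?_) x
    have hy : y.1 ∈ maximalIdeal R • (⊤ : Submodule R A) := hmin _ (by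
      rw [show f y.1 = 0 from y.2]; exact zero_mem _)
    have hle : maximalIdeal R • (⊤ : Submodule R A) ≤
        (maximalIdeal R • (⊤ : Submodule R (LinearMap.ker f))).comap κ :=
      Submodule.smul_le.2 fun r hr y _ ↦ by
        rw [Submodule.mem_comap, LinearMap.map_smul]
        exact Submodule.smul_mem_smul hr Submodule.mem_top
    have := hle hy
    rwa [Submodule.mem_comap, hκ] at this
  refine ⟨τ ∘ₗ ρ, LinearMap.ext fun a ↦ ?_⟩
  rw [LinearMap.comp_apply, LinearMap.comp_apply, hρf]
  have : κ a = 0 := hker _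
  have := congrArg Subtype.val this
  exact (sub_eq_zero.1 this).symm

end StablyFinite

end ProjectiveModules

/-! ### Boundaries, cokernels and homology of a sequence of modules; the depth chase. -/

noncomputable section Sequences

variable {R : Type u} [CommRing R] {X : ℤ → Type u} [∀ i, AddCommGroup (X i)]
  [∀ i, Module R (X i)] (d : ∀ i, X (i + 1) →ₗ[R] X i)

/-- The cokernel of the differential into degree `i`. -/
abbrev CokerAt (i : ℤ) : Type u := X i ⧸ LinearMap.range (d i)

/-- The homology in degree `i + 1` of the complex with differentials `d`. -/
abbrev HomologyAt (i : ℤ) : Type u :=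
  LinearMap.ker (d i) ⧸ (LinearMap.range (d (i + 1))).submoduleOf (LinearMap.ker (d i))

namespace HomologyAt

/-- The inclusion of the homology into the cokernel of the differential. -/
def toCoker (i : ℤ) : HomologyAt d i →ₗ[R] CokerAt d (i + 1) :=
  Submodule.mapQ _ _ (LinearMap.ker (d i)).subtype le_rfl

lemma toCoker_injective (i : ℤ) : Function.Injective (toCoker d i) := by
  rw [injective_iff_map_eq_zero]
  intro x hx
  obtain ⟨x, rfl⟩ := Submodule.Quotient.mk_surjective _ x
  exact (Submodule.Quotient.mk_eq_zero _).2
    ((Submodule.Quotient.mk_eq_zero (LinearMap.range (d (i + 1))) (x := x.1)).1 hx)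

variable {d} (hd : ∀ i, d i ∘ₗ d (i + 1) = 0)

include hd in
lemma range_le_ker (i : ℤ) : LinearMap.range (d (i + 1)) ≤ LinearMap.ker (d i) := by
  rintro _ ⟨x, rfl⟩
  exact LinearMap.congr_fun (hd i) x

/-- The map from the cokernel of a differential onto the image of the next one. -/
def cokerToRange (i : ℤ) : CokerAt d (i + 1) →ₗ[R] LinearMap.range (d i) :=
  Submodule.liftQ _ (d i).rangeRestrict (by
    rw [LinearMap.ker_rangeRestrict]
    exact range_le_ker hd i)

lemma cokerToRange_surjective (i : ℤ) : Function.Surjective (cokerToRange hd i) := by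
  intro y
  obtain ⟨x, rfl⟩ := (d i).surjective_rangeRestrict y
  exact ⟨Submodule.Quotient.mk x, rfl⟩

lemma exact_toCoker_cokerToRange (i : ℤ) :
    Function.Exact (toCoker d i) (cokerToRange hd i) := by
  intro x
  obtain ⟨x, rfl⟩ := Submodule.Quotient.mk_surjective _ x
  constructor
  · intro hx
    exact ⟨Submodule.Quotient.mk ⟨x, congrArg Subtype.val hx⟩, rfl⟩
  · rintro ⟨y, hy⟩
    rw [← hy]
    obtain ⟨⟨y, hy'⟩, rfl⟩ := Submodule.Quotient.mk_surjective _ y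
    exact Subtype.ext hy'

lemma exact_subtype_rangeRestrict (i : ℤ) :
    Function.Exact (LinearMap.ker (d i)).subtype (d i).rangeRestrict := by
  rw [LinearMap.exact_iff]
  simp

lemma exact_inclusion_mkQ (i : ℤ) : Function.Exact (Submodule.inclusion (range_le_ker hd i))
    ((LinearMap.range (d (i + 1))).submoduleOf (LinearMap.ker (d i))).mkQ := by
  rw [LinearMap.exact_iff, Submodule.ker_mkQ, Submodule.range_inclusion]
  rfl

lemma exact_subtype_mkQ (i : ℤ) : Function.Exact (LinearMap.range (d i)).subtype
    (LinearMap.range (d i)).mkQ :=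
  LinearMap.exact_subtype_mkQ _

end HomologyAt

open HomologyAt

section DepthChase

variable {d} (hd : ∀ i, d i ∘ₗ d (i + 1) = 0)
  {L : Type u} [AddCommGroup L] [Module R L]

lemma ModExt.subsingleton_of_subsingleton {A : Type u} [AddCommGroup A] [Module R A]
    [Subsingleton A] (n : ℕ) : Subsingleton (ModExt R L A n) := by
  refine subsingleton_of_forall_eq 0 fun x ↦ ?_
  rw [← ModExt.map_id_apply n x, Subsingleton.elim (LinearMap.id : A →ₗ[R] A) 0, ModExt.map_zero]
  rfl

include hd

lemma subsingleton_ext_coker {i : ℤ} {j : ℕ} (hH : Subsingleton (ModExt R L (HomologyAt d i) j))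
    (hB : Subsingleton (ModExt R L (LinearMap.range (d i)) j)) :
    Subsingleton (ModExt R L (CokerAt d (i + 1)) j) :=
  ModExt.subsingleton_mid (toCoker_injective d i) (cokerToRange_surjective hd i)
    (exact_toCoker_cokerToRange hd i) hH hB

omit hd in
lemma subsingleton_ext_range {i : ℤ} {j : ℕ} (hX : Subsingleton (ModExt R L (X i) j))
    (hW : ∀ m, m + 1 = j → Subsingleton (ModExt R L (CokerAt d i) m)) :
    Subsingleton (ModExt R L (LinearMap.range (d i)) j) :=
  ModExt.subsingleton_left Subtype.val_injective (Submodule.mkQ_surjective _)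
    (exact_subtype_mkQ i) hX hW

/-- Climb from the zero modules at the bottom. The inclusion of the boundaries B_i in X_i shifts the
degree of coker d_i by one, which is why the homology is needed only for j + 1 < a. -/
lemma subsingleton_ext_range_of_bounded {b : ℤ} (hb : ∀ i ≤ b, Subsingleton (X i)) {a : ℕ}
    (hX : ∀ i, ∀ j < a, Subsingleton (ModExt R L (X i) j))
    (hH : ∀ i j, j + 1 < a → Subsingleton (ModExt R L (HomologyAt d i) j)) (i : ℤ) :
    ∀ j < a, Subsingleton (ModExt R L (LinearMap.range (d i)) j) := by
  have hsmall (i : ℤ) (hi : i ≤ b) (j : ℕ) :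
      Subsingleton (ModExt R L (LinearMap.range (d i)) j) := by
    have := hb i hi
    exact ModExt.subsingleton_of_subsingleton j
  obtain hi | hi := le_total i b
  · exact fun j _ ↦ hsmall i hi j
  · induction i, hi using Int.leInduction with
    | base => exact fun j _ ↦ hsmall b le_rfl j
    | succ i _ ih =>
      intro j hj
      refine subsingleton_ext_range (hX _ j hj) fun m hm ↦ ?_
      subst hm
      exact subsingleton_ext_coker hd (hH i m hj) (ih m (by omega))

variable {s τ : ℤ} {δ c : ℕ} (hτ : τ = s + δ)
  (hX : ∀ i, ∀ j < c, Subsingleton (ModExt R L (X i) j))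
  (htop : Subsingleton (X (τ + 1 + 1)))
  (hH : ∀ i, s < i → Subsingleton (HomologyAt d i))
  (hinj : ¬ Function.Injective (ModExt.map L c (d τ)))

include hτ hX htop hH hinj

/-- Here τ is the target degree of the top differential, and homology vanishes above degree s + 1.
Non-injectivity at the top forces Ext^(c-1)(L, coker d_τ) ≠ 0. Further down, exactness identifies
coker d_(i+1) with the image of d_i in X_i, so each step lowers the first non-vanishing degree by
one. -/
lemma ext_coker_of_not_injective (m : ℕ) : ∀ i : ℤ, i + m = τ → s + 1 ≤ i → m + 1 ≤ c ∧
    (∀ j, j + m + 1 < c → Subsingleton (ModExt R L (CokerAt d i) j)) ∧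
    ¬ Subsingleton (ModExt R L (CokerAt d i) (c - (m + 1))) := by
  induction m with
  | zero =>
    intro i hi hsi
    obtain rfl : i = τ := by simpa using hi
    have hker : Function.Injective (d i) := by
      rw [← LinearMap.ker_eq_bot, eq_bot_iff]
      intro x hx
      have := hH _ (show s < i by omega)
      have h0 : (Submodule.Quotient.mk ⟨x, hx⟩ : HomologyAt d i) = 0 :=
        Subsingleton.elim _ _
      obtain ⟨y, hy⟩ := (Submodule.Quotient.mk_eq_zero _).1 h0
      rw [Subsingleton.elim y 0, map_zero] at hy
      exact hy.symm
    have hex : Function.Exact (d i) (LinearMap.range (d i)).mkQ := by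
      rw [LinearMap.exact_iff, Submodule.ker_mkQ]
    have hni (h : ∀ m, m + 1 = c → Subsingleton (ModExt R L (CokerAt d i) m)) : False :=
      hinj (ModExt.injective_map hker (Submodule.mkQ_surjective _) hex h)
    have hc : 1 ≤ c := by
      by_contra! h0
      exact hni (by omega)
    refine ⟨by omega, fun j hj ↦ ?_, fun h ↦ hni fun m hm ↦ ?_⟩
    · exact ModExt.subsingleton_right hker (Submodule.mkQ_surjective _) hex (hX _ _ (by omega))
        (hX _ _ (by omega))
    · obtain rfl : m = c - (0 + 1) := by omega
      exact h
  | succ m ih =>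
    intro i hi hsi
    obtain ⟨hc, hv, hn⟩ := ih (i + 1) (by push_cast at hi; omega) (by omega)
    have := hH i (by omega)
    let e : CokerAt d (i + 1) ≃ₗ[R] LinearMap.range (d i) :=
      LinearEquiv.ofBijective (cokerToRange hd i) ⟨by
        rw [← LinearMap.ker_eq_bot, (exact_toCoker_cokerToRange hd i).linearMap_ker_eq,
          LinearMap.range_eq_bot]
        exact Subsingleton.elim _ _, cokerToRange_surjective hd i⟩
    have he (j : ℕ) := ModExt.subsingleton_congr (L := L) e j
    -- Otherwise the non-vanishing group is Hom(L, B_i), which embeds in Hom(L, X_i) = 0.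
    have hc' : m + 1 ≠ c := by
      intro h
      apply hn
      rw [h, Nat.sub_self, he]
      exact subsingleton_ext_range (hX _ _ (by omega)) (by omega)
    refine ⟨by omega, fun j hj ↦ ?_, fun h ↦ hn ?_⟩
    · refine ModExt.subsingleton_right Subtype.val_injective (Submodule.mkQ_surjective _)
        (exact_subtype_mkQ i) (hX _ _ (by omega)) ((he _).1 (hv _ (by omega)))
    · rw [he]
      refine subsingleton_ext_range (hX _ _ (by omega)) fun m' hm' ↦ ?_
      obtain rfl : m' = c - (m + 1 + 1) := by omega
      exact h

/-- Comparison of depths along a bounded complex all of whose homology modules are sums of copies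
of `M`. -/
theorem exists_depth_of_not_injective {b : ℤ} (hb : ∀ i ≤ b, Subsingleton (X i))
    (M : Type u) [AddCommGroup M] [Module R M]
    (hM : ∀ i, ∃ n : ℕ, Nonempty (HomologyAt d i ≃ₗ[R] (Fin n → M)))
    (hs : Nontrivial (HomologyAt d s)) :
    ∃ e, c = e + δ ∧ (∀ j < e, Subsingleton (ModExt R L M j)) ∧
      ¬ Subsingleton (ModExt R L M e) := by
  have hHM (i : ℤ) {j : ℕ} (h : Subsingleton (ModExt R L M j)) :
      Subsingleton (ModExt R L (HomologyAt d i) j) := by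
    obtain ⟨n, ⟨e⟩⟩ := hM i
    exact (ModExt.subsingleton_congr e j).2 (ModExt.subsingleton_pi h)
  have hMH {j : ℕ} (h : Subsingleton (ModExt R L (HomologyAt d s) j)) :
      Subsingleton (ModExt R L M j) := by
    obtain ⟨n, ⟨e⟩⟩ := hM s
    obtain _ | n := n
    · exact (not_subsingleton _ e.toEquiv.subsingleton).elim
    rw [ModExt.subsingleton_congr e j] at h
    exact (ModExt.injective_map_of_leftInverse (L := L)
      (f := LinearMap.single R (fun _ ↦ M) (0 : Fin (n + 1)))
      (g := LinearMap.proj 0) (by ext; simp) j).subsingleton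
  -- the cokernel in the top degree with nonzero homology
  have hW : δ ≤ c ∧ ∀ j, j + δ < c → Subsingleton (ModExt R L (CokerAt d (s + 1)) j) := by
    obtain _ | m := δ
    · refine ⟨by omega, fun j hj ↦ ?_⟩
      obtain rfl : τ = s := by simpa using hτ
      have h0 : Subsingleton (LinearMap.range (d (τ + 1))) :=
        (d (τ + 1)).surjective_rangeRestrict.subsingleton
      exact ModExt.subsingleton_right Subtype.val_injective (Submodule.mkQ_surjective _)
        (exact_subtype_mkQ _) (hX _ _ (by omega)) (ModExt.subsingleton_of_subsingleton _)
    · obtain ⟨h1, h2, -⟩ := ext_coker_of_not_injective hd hτ hX htop hH hinj m (s + 1)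
        (by rw [hτ]; push_cast; ring) le_rfl
      exact ⟨h1, fun j hj ↦ h2 j (by omega)⟩
  obtain ⟨hδ, hW⟩ := hW
  -- Suppose Ext^e(L, M) = 0 for all e ≤ c - δ. If δ = 0, both factors of d_τ through its image are
  -- injective on Ext^c, contradicting `hinj`. If δ > 0, homology and boundaries force Ext^(c-δ)(L,
  -- coker d_(s+1)) = 0, against the descent from the top.
  have hex : ∃ e ≤ c - δ, ¬ Subsingleton (ModExt R L M e) := by
    by_contra! hall
    obtain _ | m := δ
    · have hBc := subsingleton_ext_range_of_bounded hd hb hX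
        fun i j hj ↦ hHM i (hall j (by omega))
      obtain rfl : τ = s := by simpa using hτ
      obtain ⟨i, rfl⟩ : ∃ i, τ = i + 1 := ⟨τ - 1, by ring⟩
      apply hinj
      have h1 : Function.Injective (ModExt.map L c (LinearMap.range (d (i + 1))).subtype) :=
        ModExt.injective_map Subtype.val_injective (Submodule.mkQ_surjective _)
          (exact_subtype_mkQ _) fun m hm ↦ subsingleton_ext_coker hd (hHM i (hall m (by omega)))
            (hBc i m (by omega))
      have h0 : Subsingleton (LinearMap.range (d (i + 1 + 1))) :=
        (d (i + 1 + 1)).surjective_rangeRestrict.subsingleton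
      have h2 : Subsingleton (ModExt R L (LinearMap.ker (d (i + 1))) c) :=
        ModExt.subsingleton_mid (Submodule.inclusion_injective (range_le_ker hd (i + 1)))
          (Submodule.mkQ_surjective _) (exact_inclusion_mkQ hd (i + 1))
          (ModExt.subsingleton_of_subsingleton _) (hHM _ (hall c (by omega)))
      have h3 : Function.Injective (ModExt.map L c (d (i + 1)).rangeRestrict) := by
        rw [injective_iff_map_eq_zero]
        intro x hx
        obtain ⟨y, rfl⟩ := (ModExt.exact_map L Subtype.val_injective
          (d (i + 1)).surjective_rangeRestrict (exact_subtype_rangeRestrict (i + 1)) c x).1 hx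
        rw [Subsingleton.elim y 0, map_zero]
      have h4 : ⇑(ModExt.map L c (d (i + 1))) =
          ModExt.map L c (LinearMap.range (d (i + 1))).subtype ∘
            ModExt.map L c (d (i + 1)).rangeRestrict := by
        ext x
        rw [Function.comp_apply, ← ModExt.map_comp_apply]
        rfl
      rw [h4]
      exact h1.comp h3
    · obtain ⟨h1, -, h3⟩ := ext_coker_of_not_injective hd hτ hX htop hH hinj m (s + 1)
        (by rw [hτ]; push_cast; ring) le_rfl
      apply h3
      have hB := subsingleton_ext_range_of_bounded (a := c - (m + 1) + 1) hd hb
        (fun i j hj ↦ hX i j (by omega)) (fun i j hj ↦ hHM i (hall j (by omega)))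
      exact subsingleton_ext_coker hd (hHM _ (hall _ le_rfl)) (hB s _ (by omega))
  classical
  have hex' : ∃ e, ¬ Subsingleton (ModExt R L M e) := hex.imp fun _ h ↦ h.2
  obtain ⟨e₀, he₀, hne₀⟩ := hex
  have hle : Nat.find hex' ≤ c - δ := (Nat.find_min' hex' hne₀).trans he₀
  have hlow (j : ℕ) (hj : j < Nat.find hex') : Subsingleton (ModExt R L M j) :=
    not_not.1 (Nat.find_min hex' hj)
  refine ⟨Nat.find hex', ?_, hlow, Nat.find_spec hex'⟩
  by_contra hne
  -- With e the least non-vanishing degree for M, the boundaries have no Ext^(e-1), so Ext^e of the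
  -- top homology embeds in Ext^e(L, coker d_(s+1)). The latter is zero when e + δ < c.
  have hlt : Nat.find hex' + δ < c := by omega
  have hB := subsingleton_ext_range_of_bounded (a := Nat.find hex' + 1) hd hb
    (fun i j hj ↦ hX i j (by omega)) (fun i j hj ↦ hHM i (hlow j (by omega)))
  apply Nat.find_spec hex'
  apply hMH
  exact ModExt.subsingleton_left (toCoker_injective d s) (cokerToRange_surjective hd s)
    (exact_toCoker_cokerToRange hd s) (hW _ hlt) fun m hm ↦ hB s m (by omega)

end DepthChase

end Sequences

/-! ### Comparing the homology of X with that of X ⊗ C. -/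

noncomputable section TensorHomology

open HomologyAt TensorProduct

variable {R : Type u} [CommRing R]

/-- A property of modules that passes to the middle term of an exact sequence and holds for zero
modules. -/
structure IsThickProperty (R : Type u) [CommRing R]
    (Φ : ∀ (A : Type u) [AddCommGroup A] [Module R A], Prop) : Prop where
  of_subsingleton : ∀ (A : Type u) [AddCommGroup A] [Module R A], Subsingleton A → Φ A
  of_exact : ∀ {A B D : Type u} [AddCommGroup A] [Module R A] [AddCommGroup B] [Module R B]
    [AddCommGroup D] [Module R D] {f : A →ₗ[R] B} {g : B →ₗ[R] D},
    Function.Exact f g → Φ A → Φ D → Φ B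

lemma isThickProperty_subsingleton :
    IsThickProperty R fun A [AddCommGroup A] [Module R A] ↦ Subsingleton A where
  of_subsingleton _ _ _ h := h
  of_exact h hA hD := ModExt.subsingleton_of_exact h hA hD

lemma isThickProperty_finite [IsNoetherianRing R] :
    IsThickProperty R fun A [AddCommGroup A] [Module R A] ↦ Module.Finite R A where
  of_subsingleton _ _ _ _ := inferInstance
  of_exact h hA hD := Module.Finite.of_exact_of_isNoetherianRing h hA hD

namespace IsThickProperty

variable {Φ : ∀ (A : Type u) [AddCommGroup A] [Module R A], Prop} (hΦ : IsThickProperty R Φ)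
  {A B E U : Type u} [AddCommGroup A] [Module R A] [AddCommGroup B] [Module R B]
  [AddCommGroup E] [Module R E] [AddCommGroup U] [Module R U]

include hΦ

lemma of_injective {f : A →ₗ[R] B} (hf : Function.Injective f) (hB : Φ B) : Φ A := by
  refine hΦ.of_exact (f := (0 : PUnit.{u + 1} →ₗ[R] A)) (g := f) (fun x ↦ ?_)
    (hΦ.of_subsingleton _ inferInstance) hB
  rw [← map_zero f, hf.eq_iff]
  exact ⟨fun h ↦ ⟨0, h.symm⟩, fun ⟨_, h⟩ ↦ h.symm⟩

/-- The map f factors through A / ker δ, which embeds in E. -/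
lemma of_exact_of_ker_le {δ : A →ₗ[R] E} {f : A →ₗ[R] B} {v : B →ₗ[R] U}
    (hle : LinearMap.ker δ ≤ LinearMap.ker f) (h : Function.Exact f v) (hE : Φ E) (hU : Φ U) :
    Φ B := by
  refine hΦ.of_exact (f := (LinearMap.ker δ).liftQ f hle) (g := v) ?_
    (hΦ.of_injective (f := (LinearMap.ker δ).liftQ δ le_rfl) ?_ hE) hU
  · rw [LinearMap.exact_iff, Submodule.range_liftQ, h.linearMap_ker_eq]
  · rw [← LinearMap.ker_eq_bot]
    exact Submodule.ker_liftQ_eq_bot _ _ _ le_rfl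

end IsThickProperty

section

variable {X : ℤ → Type u} [∀ i, AddCommGroup (X i)] [∀ i, Module R (X i)]
  {d : ∀ i, X (i + 1) →ₗ[R] X i} (hd : ∀ i, d i ∘ₗ d (i + 1) = 0)

section Thick

variable {Φ : ∀ (A : Type u) [AddCommGroup A] [Module R A], Prop} (hΦ : IsThickProperty R Φ)
  {L : Type u} [AddCommGroup L] [Module R L]

include hΦ hd

lemma thick_ext_ker {i : ℤ} {j : ℕ} (hB : Φ (ModExt R L (LinearMap.range (d (i + 1))) j))
    (hH : Φ (ModExt R L (HomologyAt d i) j)) : Φ (ModExt R L (LinearMap.ker (d i)) j) :=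
  hΦ.of_exact (ModExt.exact_map L (Submodule.inclusion_injective (range_le_ker hd i))
    (Submodule.mkQ_surjective _) (exact_inclusion_mkQ hd i) j) hB hH

/-- Descend from the zero modules at the top: as Ext^j(L, X_(i+1)) = 0 for j > 0, Ext^j of the image
of d_i embeds in Ext^(j+1) of ker d_i, which is controlled by the next boundaries and the homology.
-/
lemma thick_ext_range {b n : ℤ} (hb : ∀ i, b ≤ i → Subsingleton (X i))
    (hX : ∀ i j, 0 < j → Subsingleton (ModExt R L (X i) j))
    (hH : ∀ i, n ≤ i → ∀ j, Φ (ModExt R L (HomologyAt d i) j)) (i : ℤ) (hi : n ≤ i) :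
    ∀ j, 0 < j → Φ (ModExt R L (LinearMap.range (d i)) j) := by
  have hlarge (i : ℤ) (hi : b ≤ i) (j : ℕ) : Φ (ModExt R L (LinearMap.range (d i)) j) := by
    have := hb i hi
    exact hΦ.of_subsingleton _ (ModExt.subsingleton_of_subsingleton j)
  obtain hbi | hbi := le_total b i
  · exact fun j _ ↦ hlarge i hbi j
  · induction i, hbi using Int.leInductionDown with
    | base => exact fun j _ ↦ hlarge b le_rfl j
    | pred i hib ih =>
      intro j hj
      obtain ⟨i, rfl⟩ : ∃ k, i = k + 1 := ⟨i - 1, by ring⟩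
      rw [add_sub_cancel_right] at *
      obtain ⟨δ, h1, -⟩ := ModExt.exists_connecting L (Subtype.val_injective)
        (d i).surjective_rangeRestrict (exact_subtype_rangeRestrict i) j
      exact hΦ.of_exact h1 (hΦ.of_subsingleton _ (hX _ _ hj))
        (thick_ext_ker hd hΦ (ih (by omega) (j + 1) (by omega)) (hH i hi _))

end Thick

variable {C : Type u} [AddCommGroup C] [Module R C] (hC : IsSemidualizing R C)
  [∀ i, Module.Projective R (X i)]

/-- The differentials of `X ⊗ C`. -/
abbrev tensorDiff (d : ∀ i, X (i + 1) →ₗ[R] X i) (C : Type u) [AddCommGroup C] [Module R C]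
    (i : ℤ) : X (i + 1) ⊗[R] C →ₗ[R] X i ⊗[R] C := (d i).rTensor C

omit [∀ i, Module.Projective R (X i)] in
include hd in
lemma rTensor_comp_rTensor_eq_zero (i : ℤ) :
    tensorDiff d C i ∘ₗ tensorDiff d C (i + 1) = 0 := by
  rw [← LinearMap.rTensor_comp, hd, LinearMap.rTensor_zero]

/-- The comparison `Z(X) → Hom(C, Z(X ⊗ C))` on cycles. -/
def cyclesComparison (d : ∀ i, X (i + 1) →ₗ[R] X i) (C : Type u) [AddCommGroup C] [Module R C]
    (i : ℤ) : LinearMap.ker (d i) →ₗ[R] (C →ₗ[R] LinearMap.ker ((d i).rTensor C)) where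
  toFun p := (TensorProduct.mk R _ C p.1).codRestrict _ fun c ↦ by
    rw [LinearMap.mem_ker, TensorProduct.mk_apply, LinearMap.rTensor_tmul,
      LinearMap.mem_ker.1 p.2, zero_tmul]
  map_add' p q := by ext c; simp
  map_smul' r p := by ext c; simp [smul_tmul']

-- Each X_i → Hom(C, X_i ⊗ C) is an isomorphism, and Hom(C, -) preserves kernels.
include hC in
lemma cyclesComparison_bijective (i : ℤ) : Function.Bijective (cyclesComparison d C i) := by
  constructor
  · intro p q hpq
    apply Subtype.ext
    apply (hC.mk_bijective (P := X (i + 1))).1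
    ext c
    exact congrArg Subtype.val (LinearMap.congr_fun hpq c)
  · intro ψ
    obtain ⟨p, hp⟩ := (hC.mk_bijective (P := X (i + 1))).2 ((LinearMap.ker _).subtype ∘ₗ ψ)
    have hp' (c : C) : p ⊗ₜ[R] c = (ψ c).1 := LinearMap.congr_fun hp c
    refine ⟨⟨p, (hC.mk_bijective (P := X i)).1 ?_⟩, ?_⟩
    · ext c
      have h1 : (d i).rTensor C (p ⊗ₜ[R] c) = 0 := by
        rw [hp']
        exact (ψ c).2
      simpa using h1
    · ext c
      exact hp' c

/-- The comparison `H(X) → Hom(C, H(X ⊗ C))`. -/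
def homologyComparison (d : ∀ i, X (i + 1) →ₗ[R] X i) (C : Type u) [AddCommGroup C] [Module R C]
    (i : ℤ) : HomologyAt d i →ₗ[R] (C →ₗ[R] HomologyAt (X := fun i ↦ X i ⊗[R] C) (tensorDiff d C) i) :=
  Submodule.liftQ _ ((Submodule.mkQ _).compRight R ∘ₗ cyclesComparison d C i) (by
    rintro ⟨_, _⟩ ⟨x, rfl⟩
    ext c
    exact (Submodule.Quotient.mk_eq_zero _).2 ⟨x ⊗ₜ c, rfl⟩)

include hd hC

/-- With B and Z the image and kernel of d_(i+1) ⊗ C, the kernel of H(X) → Hom(C, H(X ⊗ C)) is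
Hom(C, B) modulo maps lifting to X_(i+2) ⊗ C, hence embeds in Ext¹(C, Z). Taking Φ to be "zero" and
"finite" transfers both properties from X ⊗ C to X. -/
lemma thick_homology {Φ : ∀ (A : Type u) [AddCommGroup A] [Module R A], Prop}
    (hΦ : IsThickProperty R Φ) [IsNoetherianRing R] {b n : ℤ}
    (hb : ∀ i, b ≤ i → Subsingleton (X i))
    (hH : ∀ i, n ≤ i → ∀ j, Φ (ModExt R C (HomologyAt (X := fun i ↦ X i ⊗[R] C) (tensorDiff d C) i) j))
    (i : ℤ) (hi : n ≤ i) : Φ (HomologyAt d i) := by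
  have := hC.finite
  have hdC := rTensor_comp_rTensor_eq_zero (C := C) hd
  have hb' (i) (h : b ≤ i) : Subsingleton (X i ⊗[R] C) := by
    have := hb i h
    infer_instance
  have hX (i) (j : ℕ) (hj : 0 < j) : Subsingleton (ModExt R C (X i ⊗[R] C) j) :=
    ModExt.subsingleton_tensor (hC.ext_vanishing j hj)
  have hker : Φ (ModExt R C (LinearMap.ker ((d (i + 1)).rTensor C)) 1) :=
    thick_ext_ker (X := fun i ↦ X i ⊗[R] C) (d := tensorDiff d C) hdC hΦ
      (thick_ext_range (X := fun i ↦ X i ⊗[R] C) (d := tensorDiff d C) hdC hΦ hb' hX hH _ (by omega) 1 one_pos)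
      (hH _ (by omega) 1)
  obtain ⟨δ, hδ, -⟩ := ModExt.exists_connecting C Subtype.val_injective
    ((d (i + 1)).rTensor C).surjective_rangeRestrict
    (exact_subtype_rangeRestrict (X := fun i ↦ X i ⊗[R] C) (d := tensorDiff d C) (i + 1)) 0
  let e := LinearEquiv.ofBijective _ (cyclesComparison_bijective (d := d) hC i)
  have he (p) (c : C) : (e p c).1 = p.1 ⊗ₜ[R] c := rfl
  let f : (C →ₗ[R] LinearMap.range ((d (i + 1)).rTensor C)) →ₗ[R] HomologyAt d i :=
    Submodule.mkQ _ ∘ₗ e.symm.toLinearMap ∘ₗ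
      (Submodule.inclusion (range_le_ker (X := fun i ↦ X i ⊗[R] C) (d := tensorDiff d C) hdC i)).compRight R
  have hf (φ) (p) (hp : ∀ c, (φ c).1 = p.1 ⊗ₜ[R] c) : f φ = Submodule.Quotient.mk p := by
    have : e.symm ((Submodule.inclusion
        (range_le_ker (X := fun i ↦ X i ⊗[R] C) (d := tensorDiff d C) hdC i)).compRight R φ) = p := by
      rw [LinearEquiv.symm_apply_eq]
      ext c
      exact hp c
    exact congrArg Submodule.Quotient.mk this
  refine hΦ.of_exact_of_ker_le (A := C →ₗ[R] LinearMap.range ((d (i + 1)).rTensor C)) (δ := δ ∘ₗ (ModExt.zeroEquiv C _).symm.toLinearMap) (f := f)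
    (v := homologyComparison d C i) ?_ ?_ hker
    (hΦ.of_injective (f := (ModExt.zeroEquiv C _).symm.toLinearMap)
      (ModExt.zeroEquiv C _).symm.injective (hH i hi 0))
  -- A map killed by δ lifts to X_(i+2) ⊗ C, hence comes from some q in X_(i+2), so its class in
  -- H(X) is that of the boundary dq.
  · intro φ hφ
    obtain ⟨ψ, hψ⟩ := (hδ _).1 hφ
    obtain ⟨ψ, rfl⟩ := (ModExt.zeroEquiv C _).symm.surjective ψ
    have hψ' : ((d (i + 1)).rTensor C).rangeRestrict ∘ₗ ψ = φ := by
      have := congrArg (ModExt.zeroEquiv C _) hψ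
      rwa [ModExt.zeroEquiv_map, LinearEquiv.apply_symm_apply, LinearEquiv.coe_coe,
        LinearEquiv.apply_symm_apply] at this
    obtain ⟨q, rfl⟩ := (hC.mk_bijective (P := X (i + 1 + 1))).2 ψ
    rw [LinearMap.mem_ker, hf φ ⟨d (i + 1) q, LinearMap.congr_fun (hd i) q⟩ fun c ↦ by
      rw [← hψ']; rfl]
    exact (Submodule.Quotient.mk_eq_zero _).2 ⟨q, rfl⟩
  · intro x
    obtain ⟨p, rfl⟩ := Submodule.Quotient.mk_surjective _ x
    constructor
    · intro hx
      have hmem (c : C) : (p.1 ⊗ₜ[R] c) ∈ LinearMap.range ((d (i + 1)).rTensor C) :=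
        (Submodule.Quotient.mk_eq_zero (Submodule.submoduleOf _ _)
          (x := cyclesComparison d C i p c)).1 (LinearMap.congr_fun hx c)
      exact ⟨(TensorProduct.mk R _ C p.1).codRestrict _ hmem, hf _ _ fun c ↦ rfl⟩
    · rintro ⟨φ, hφ⟩
      rw [← hφ]
      obtain ⟨q, hq⟩ := e.surjective ((Submodule.inclusion
        (range_le_ker (X := fun i ↦ X i ⊗[R] C) (d := tensorDiff d C) hdC i)).compRight R φ)
      have hq' (c) : (φ c).1 = q.1 ⊗ₜ[R] c :=
        (congrArg Subtype.val (LinearMap.congr_fun hq c)).symm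
      rw [hf φ q hq']
      ext c
      refine (Submodule.Quotient.mk_eq_zero _).2 ?_
      change q.1 ⊗ₜ[R] c ∈ LinearMap.range ((d (i + 1)).rTensor C)
      rw [← hq']
      exact (φ c).2

-- If Hom(C, M) = 0, some element of Ann C is regular on M. But Ann C = 0 by the homothety
-- isomorphism, and 0 is not regular on M ≠ 0.
omit hd hC [∀ i, Module.Projective R (X i)] in
lemma IsSemidualizing.nontrivial_linearMap [IsNoetherianRing R] (hC : IsSemidualizing R C)
    (M : Type u) [AddCommGroup M]
    [Module R M] [Module.Finite R M] [Nontrivial M] : Nontrivial (C →ₗ[R] M) := by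
  have := hC.finite
  by_contra h
  rw [not_nontrivial_iff_subsingleton, IsSMulRegular.subsingleton_linearMap_iff] at h
  obtain ⟨r, hr, hreg⟩ := h
  have hr0 : r = 0 := by
    apply hC.homothety_bijective.1
    ext c
    simpa using Module.mem_annihilator.1 hr c
  subst hr0
  obtain ⟨x, hx⟩ := exists_ne (0 : M)
  exact hx (hreg (by simp))

/-- In the top homological degree Ext¹(C, B) = 0 for the boundaries B, so Hom(C, Z) → Hom(C, H) is
surjective. Therefore H(X) surjects onto Hom(C, H(X ⊗ C)), which is nonzero. -/
lemma nontrivial_homology [IsNoetherianRing R] {b s : ℤ}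
    (hb : ∀ i, b ≤ i → Subsingleton (X i))
    (hH : ∀ i, s < i → Subsingleton (HomologyAt (X := fun i ↦ X i ⊗[R] C) (tensorDiff d C) i))
    (hfin : Module.Finite R (HomologyAt (X := fun i ↦ X i ⊗[R] C) (tensorDiff d C) s))
    (hs : Nontrivial (HomologyAt (X := fun i ↦ X i ⊗[R] C) (tensorDiff d C) s)) : Nontrivial (HomologyAt d s) := by
  have := hC.finite
  have hdC := rTensor_comp_rTensor_eq_zero (C := C) hd
  have hb' (i) (h : b ≤ i) : Subsingleton (X i ⊗[R] C) := by
    have := hb i h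
    infer_instance
  have hX (i) (j : ℕ) (hj : 0 < j) : Subsingleton (ModExt R C (X i ⊗[R] C) j) :=
    ModExt.subsingleton_tensor (hC.ext_vanishing j hj)
  have hB : Subsingleton (ModExt R C (LinearMap.range ((d (s + 1)).rTensor C)) 1) :=
    thick_ext_range (n := s + 1) (X := fun i ↦ X i ⊗[R] C) (d := tensorDiff d C) hdC isThickProperty_subsingleton
      hb' hX (fun i hi j ↦ by
        have := hH i (by omega)
        exact ModExt.subsingleton_of_subsingleton j) _ le_rfl 1 one_pos
  obtain ⟨δ, hδ, -⟩ := ModExt.exists_connecting C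
    (Submodule.inclusion_injective (range_le_ker (X := fun i ↦ X i ⊗[R] C) (d := tensorDiff d C) hdC s))
    (Submodule.mkQ_surjective _) (exact_inclusion_mkQ (X := fun i ↦ X i ⊗[R] C) (d := tensorDiff d C) hdC s) 0
  have hsurj : Function.Surjective (homologyComparison d C s) := by
    intro φ
    obtain ⟨ψ, hψ⟩ := (hδ ((ModExt.zeroEquiv C _).symm φ)).1 (Subsingleton.elim _ _)
    obtain ⟨ψ, rfl⟩ := (ModExt.zeroEquiv C _).symm.surjective ψ
    have hψ' := congrArg (ModExt.zeroEquiv C _) hψ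
    rw [ModExt.zeroEquiv_map, LinearEquiv.apply_symm_apply,
        LinearEquiv.apply_symm_apply] at hψ'
    obtain ⟨p, rfl⟩ := (cyclesComparison_bijective (d := d) hC s).2 ψ
    exact ⟨Submodule.Quotient.mk p, hψ'⟩
  have := hC.nontrivial_linearMap (HomologyAt (X := fun i ↦ X i ⊗[R] C) (tensorDiff d C) s)
  exact hsurj.nontrivial

-- Induct upwards: coker d_(i+1) is an extension of the image of d_i by finite homology, and that
-- image is a syzygy of coker d_i in the projective X_i.
omit hC in
lemma isStablyFinite_coker [IsNoetherianRing R] {b : ℤ} (hb : ∀ i ≤ b, Subsingleton (X i))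
    (hH : ∀ i, Module.Finite R (HomologyAt d i)) (i : ℤ) : IsStablyFinite R (CokerAt d i) := by
  have hsmall (i : ℤ) (hi : i ≤ b) : IsStablyFinite R (CokerAt d i) := by
    have := hb i hi
    exact .of_subsingleton
  obtain hi | hi := le_total i b
  · exact hsmall i hi
  · induction i, hi using Int.leInduction with
    | base => exact hsmall b le_rfl
    | succ i _ ih =>
      exact .of_extension (exact_toCoker_cokerToRange hd i) (cokerToRange_surjective hd i) (hH i)
        (.syzygy Subtype.val_injective (exact_subtype_mkQ i) (Submodule.mkQ_surjective _) ih)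

end

end TensorHomology

/-! ### Extremal degrees, explicit homology, and splitting off a contractible summand. -/

noncomputable section Complexes

open HomologyAt TensorProduct

section Degrees

/-- `s` is the largest integer satisfying `p`. -/
def IsTopDegree (p : ℤ → Prop) (s : ℤ) : Prop := p s ∧ ∀ i, s < i → ¬ p i

variable {p : ℤ → Prop}

lemma IsTopDegree.iSup_eq {s : ℤ} (h : IsTopDegree p s) :
    (⨆ (i : ℤ) (_ : p i), ((i : ℝ) : EReal)) = ((s : ℝ) : EReal) := by
  refine le_antisymm (iSup₂_le fun i hi ↦ ?_) (le_iSup₂_of_le s h.1 le_rfl)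
  have : i ≤ s := not_lt.1 fun hlt ↦ h.2 i hlt hi
  exact_mod_cast this

lemma iSup_lt_top_iff :
    (⨆ (i : ℤ) (_ : p i), ((i : ℝ) : EReal)) < ⊤ ↔ ∃ b : ℤ, ∀ i, b ≤ i → ¬ p i := by
  constructor
  · intro h
    by_contra! H
    refine h.ne (EReal.eq_top_iff_forall_lt _ |>.2 fun y ↦ ?_)
    obtain ⟨n, hn⟩ := exists_int_gt y
    obtain ⟨i, hi, hp⟩ := H n
    refine lt_of_lt_of_le ?_ (le_iSup₂_of_le i hp le_rfl)
    exact EReal.coe_lt_coe_iff.2 (hn.trans_le (by exact_mod_cast hi))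
  · rintro ⟨b, hb⟩
    refine lt_of_le_of_lt (iSup₂_le fun i hi ↦ ?_) (EReal.coe_lt_top (b : ℝ))
    have : i ≤ b := le_of_lt (not_le.1 fun hle ↦ hb i hle hi)
    exact_mod_cast this

lemma bot_lt_iInf_iff :
    ⊥ < (⨅ (i : ℤ) (_ : p i), ((i : ℝ) : EReal)) ↔ ∃ b : ℤ, ∀ i, i ≤ b → ¬ p i := by
  constructor
  · intro h
    by_contra! H
    refine h.ne' (EReal.eq_bot_iff_forall_lt _ |>.2 fun y ↦ ?_)
    obtain ⟨n, hn⟩ := exists_int_lt y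
    obtain ⟨i, hi, hp⟩ := H n
    refine lt_of_le_of_lt (iInf₂_le_of_le i hp le_rfl) ?_
    exact EReal.coe_lt_coe_iff.2 (lt_of_le_of_lt (by exact_mod_cast hi) hn)
  · rintro ⟨b, hb⟩
    refine lt_of_lt_of_le (EReal.bot_lt_coe (b : ℝ)) (le_iInf₂ fun i hi ↦ ?_)
    have : b ≤ i := le_of_lt (not_le.1 fun hle ↦ hb i hle hi)
    exact_mod_cast this

lemma exists_isTopDegree {b : ℤ} (hb : ∀ i, b ≤ i → ¬ p i) (hp : ∃ i, p i) :
    ∃ s, IsTopDegree p s := by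
  obtain ⟨s, hs, hs'⟩ := Int.exists_greatest_of_bdd
    ⟨b, fun z hz ↦ le_of_lt (not_le.1 fun hle ↦ hb z hle hz)⟩ hp
  exact ⟨s, hs, fun i hi hpi ↦ (hs' i hpi).not_gt hi⟩

end Degrees

variable {R : Type u} [CommRing R]

namespace ModuleComplex

/-- The differential of a complex of modules as a linear map. -/
abbrev diff (K : ModuleComplex R) (i : ℤ) : K.X (i + 1) →ₗ[R] K.X i := (K.d (i + 1) i).hom

lemma diff_comp_diff (K : ModuleComplex R) (i : ℤ) : K.diff i ∘ₗ K.diff (i + 1) = 0 := by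
  rw [← ModuleCat.hom_comp, K.d_comp_d]
  rfl

/-- The homology of a complex of modules in terms of cycles modulo boundaries. -/
def homologyEquiv (K : ModuleComplex R) (i : ℤ) : K.homology (i + 1) ≃ₗ[R]
    HomologyAt (X := fun i ↦ K.X i) K.diff i :=
  (ShortComplex.homologyMapIso (K.isoSc' (i + 1 + 1) (i + 1) i (by simp) (by simp)) ≪≫
    (K.sc' (i + 1 + 1) (i + 1) i).moduleCatHomologyIso).toLinearEquiv.trans
    (Submodule.quotEquivOfEq _ _ (by
      ext ⟨x, hx⟩
      constructor
      · rintro ⟨y, hy⟩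
        exact ⟨y, congrArg Subtype.val hy⟩
      · rintro ⟨y, hy⟩
        exact ⟨y, Subtype.ext hy⟩))

/-- The homology of `K ⊗ C` in terms of cycles modulo boundaries. -/
def tensorHomologyEquiv (K : ModuleComplex R) (C : Type u) [AddCommGroup C] [Module R C] (i : ℤ) :
    (K.tensor C).homology (i + 1) ≃ₗ[R]
      HomologyAt (X := fun i ↦ K.X i ⊗[R] C) (tensorDiff (X := fun i ↦ K.X i) K.diff C) i :=
  (K.tensor C).homologyEquiv i

lemma isBounded_iff (K : ModuleComplex R) :
    K.IsBounded ↔ (∃ b : ℤ, ∀ i, b ≤ i → Subsingleton (K.X i)) ∧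
      ∃ b : ℤ, ∀ i, i ≤ b → Subsingleton (K.X i) := by
  simp only [← not_nontrivial_iff_subsingleton]
  exact and_congr iSup_lt_top_iff bot_lt_iInf_iff

/-- A contracting homotopy of the differential into degree `t` splits off from the complex. -/
lemma exists_homotopyEquiv_of_leftInverse (K : ModuleComplex R) {t : ℤ}
    (r : K.X t →ₗ[R] K.X (t + 1))
    (hr : r ∘ₗ K.diff t = LinearMap.id) :
    ∃ (K' : ModuleComplex R) (_ : HomotopyEquiv K K') (i : K' ⟶ K) (p : K ⟶ K'),
      i ≫ p = 𝟙 K' ∧ Subsingleton (K'.X (t + 1)) := by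
  let h (i j : ℤ) (_ : (ComplexShape.down ℤ).Rel j i) : K.X i ⟶ K.X j :=
    if H : t = i ∧ t + 1 = j then H.1 ▸ H.2 ▸ ModuleCat.ofHom r else 0
  have ht (H) : h t (t + 1) H = ModuleCat.ofHom r := by simp [h]
  have hne (i j H) (hi : i ≠ t) : h i j H = 0 := by
    simp only [h]
    rw [dif_neg (fun H ↦ hi H.1.symm)]
  have hrd : K.d (t + 1) t ≫ ModuleCat.ofHom r = 𝟙 _ := ModuleCat.hom_ext hr
  have hrel (k : ℤ) : (ComplexShape.down ℤ).Rel (k + 1) k := rfl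
  have hrel' (k : ℤ) : (ComplexShape.down ℤ).Rel k (k - 1) := sub_add_cancel k 1
  -- This null-homotopic map is the identity in degree t + 1, the idempotent d ∘ r in degree t and
  -- zero elsewhere. The new complex is the image of 1 - f.
  let f : K ⟶ K := Homotopy.nullHomotopicMap' h
  have hf (k : ℤ) : f.f k = K.d k (k - 1) ≫ h (k - 1) k (hrel' k) +
      h k (k + 1) (hrel k) ≫ K.d (k + 1) k :=
    Homotopy.nullHomotopicMap'_f (c := ComplexShape.down ℤ) (hrel _) (hrel' _) h
  have hf1 : f.f (t + 1) = 𝟙 _ := by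
    have := Homotopy.nullHomotopicMap'_f (c := ComplexShape.down ℤ) (C := K) (D := K)
      (k₂ := t + 1 + 1) (k₁ := t + 1) (k₀ := t) (hrel _) (hrel _) h
    rw [ht (hrel t), hne _ _ (hrel _) (by omega : t + 1 ≠ t), Limits.zero_comp, add_zero, hrd] at this
    exact this
  have hf0 : f.f t = ModuleCat.ofHom r ≫ K.d (t + 1) t := by
    rw [hf, ht (hrel t), hne _ _ (hrel' _) (by omega : t - 1 ≠ t), Limits.comp_zero, zero_add]
  have hidem : f ≫ f = f := by
    ext1 k
    rw [HomologicalComplex.comp_f]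
    by_cases hk : k = t
    · subst hk
      rw [hf0, Category.assoc, reassoc_of% hrd]
    · by_cases hk' : k = t + 1
      · subst hk'
        rw [hf1, Category.comp_id]
      · rw [hf, hne _ _ (hrel k) hk, hne _ _ (hrel' k) (by omega : k - 1 ≠ t)]
        rw [Limits.zero_comp, Limits.comp_zero, add_zero, Limits.zero_comp]
  have hidem' : (𝟙 K - f) ≫ (𝟙 K - f) = 𝟙 K - f := by
    simp [Preadditive.sub_comp, Preadditive.comp_sub, hidem]
  obtain ⟨K', i, p, hip, hpi⟩ := IsIdempotentComplete.idempotents_split K (𝟙 K - f) hidem'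
  have hh : Homotopy (𝟙 K) (𝟙 K - f) := Homotopy.equivSubZero.symm
    ((Homotopy.ofEq (sub_sub_cancel _ _)).trans (Homotopy.nullHomotopy' h))
  refine ⟨K', ⟨p, i, (Homotopy.ofEq hpi).trans hh.symm, Homotopy.ofEq hip⟩, i, p, hip, ?_⟩
  have hzero : 𝟙 (K'.X (t + 1)) = 0 := by
    have h1 : 𝟙 K' = i ≫ (𝟙 K - f) ≫ p := by
      rw [← hpi, Category.assoc, hip, Category.comp_id, hip]
    have h2 := congrArg (fun φ ↦ HomologicalComplex.Hom.f φ (t + 1)) h1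
    simp only [HomologicalComplex.comp_f, HomologicalComplex.sub_f_apply,
      HomologicalComplex.id_f, hf1, sub_self, Limits.zero_comp, Limits.comp_zero] at h2
    exact h2
  exact ModuleCat.subsingleton_of_isZero (Limits.IsZero.iff_id_eq_zero _ |>.2 hzero)

end ModuleComplex

end Complexes

/-! ### Quasi-projective resolutions: depth count and shortening. -/

noncomputable section Resolutions

open HomologyAt TensorProduct ModuleComplex IsLocalRing

variable {R : Type u} [CommRing R] [IsNoetherianRing R] [IsLocalRing R]

section NotInjective

variable {C P Q : Type u} [AddCommGroup C] [Module R C] [AddCommGroup P] [Module R P]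
  [AddCommGroup Q] [Module R Q]

omit [IsNoetherianRing R] in
lemma map_mk_eq_zero (c : ℕ) {q : Q} (hq : q ∈ maximalIdeal R • (⊤ : Submodule R Q)) :
    ModExt.map (ResidueField R) c (TensorProduct.mk R Q C q) = 0 := by
  induction hq using Submodule.smul_induction_on' with
  | smul r hr x hx => rw [_root_.map_smul, ModExt.map_eq_zero_of_residueField c hr]
  | add x hx y hy h1 h2 => rw [_root_.map_add, ModExt.map_add, h1, h2, add_zero]

-- A functional with unit value at x splits y ↦ x ⊗ y, so this map is injective on Ext^c(k, -).
-- Followed by d ⊗ C it becomes y ↦ dx ⊗ y, which is zero there.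
omit [IsNoetherianRing R] in
lemma not_injective_map_rTensor [Module.Projective R P] {c : ℕ}
    (hc : ¬ ResidueExtVanishes (R := R) C c) (d : P →ₗ[R] Q) {x : P}
    (hx : x ∉ maximalIdeal R • (⊤ : Submodule R P))
    (hdx : d x ∈ maximalIdeal R • (⊤ : Submodule R Q)) :
    ¬ Function.Injective (ModExt.map (ResidueField R) c (d.rTensor C)) := by
  intro hinj
  obtain ⟨f, u, hu⟩ := Module.Projective.exists_isUnit_apply hx
  apply hc
  have h1 : Function.Injective (ModExt.map (ResidueField R) c (TensorProduct.mk R P C x)) := by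
    refine ModExt.injective_map_of_leftInverse
      (g := (u⁻¹ : Rˣ).1 • ((TensorProduct.lid R C).toLinearMap ∘ₗ f.rTensor C)) ?_ c
    ext y
    simp [smul_smul, ← hu]
  have h2 := hinj.comp h1
  refine subsingleton_of_forall_eq 0 fun y ↦ h2 ?_
  rw [Function.comp_apply, ← ModExt.map_comp_apply,
    show d.rTensor C ∘ₗ TensorProduct.mk R P C x = TensorProduct.mk R Q C (d x) from rfl,
    map_mk_eq_zero c hdx]
  simp

end NotInjective

variable {C M : Type u} [AddCommGroup C] [Module R C] [AddCommGroup M] [Module R M]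

/-- A `C`-quasi-projective resolution with top homological degree `s` and top degree `t`. -/
structure IsResolutionWithDegrees (C M : Type u) [AddCommGroup C] [Module R C] [AddCommGroup M]
    [Module R M] (P : ModuleComplex R) (s t : ℤ) : Prop where
  resolution : IsCQuasiProjectiveResolution R C M P
  hsup : IsTopDegree (fun i ↦ Nontrivial ((P.tensor C).homology i)) s
  sup : IsTopDegree (fun i ↦ Nontrivial (P.X i)) t

omit [IsNoetherianRing R] [IsLocalRing R] in
lemma subsingleton_homology_tensor (P : ModuleComplex R) {i : ℤ}
    (hi : Subsingleton (P.X i)) :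
    Subsingleton ((P.tensor C).homology i) := by
  obtain ⟨i, rfl⟩ : ∃ k, i = k + 1 := ⟨i - 1, by ring⟩
  have : Subsingleton (P.X (i + 1) ⊗[R] C) := inferInstance
  exact (P.tensorHomologyEquiv C i).toEquiv.subsingleton_congr.2
    (toCoker_injective (X := fun i ↦ P.X i ⊗[R] C) (tensorDiff (X := fun i ↦ P.X i) P.diff C)
      i).subsingleton

namespace IsCQuasiProjectiveResolution

variable {P : ModuleComplex R} (hP : IsCQuasiProjectiveResolution R C M P)

include hP

omit [IsNoetherianRing R] [IsLocalRing R]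

lemma exists_nontrivial_homology : ∃ i, Nontrivial ((P.tensor C).homology i) := by
  by_contra! h
  refine hP.not_acyclic fun i ↦ ?_
  rw [HomologicalComplex.exactAt_iff_isZero_homology]
  have := h i
  exact ModuleCat.isZero_of_subsingleton _

lemma exists_degrees : ∃ s t, IsResolutionWithDegrees C M P s t := by
  obtain ⟨⟨b, hb⟩, -⟩ := P.isBounded_iff.1 hP.bounded
  obtain ⟨i, hi⟩ := hP.exists_nontrivial_homology
  have hi' : Nontrivial (P.X i) := by
    by_contra h
    rw [not_nontrivial_iff_subsingleton] at h
    exact not_subsingleton_iff_nontrivial.2 hi (subsingleton_homology_tensor P h)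
  obtain ⟨s, hs⟩ := exists_isTopDegree (p := fun i ↦ Nontrivial ((P.tensor C).homology i))
    (b := b) (fun i hi ↦ not_nontrivial_iff_subsingleton.2
      (subsingleton_homology_tensor P (hb i hi))) ⟨i, hi⟩
  obtain ⟨t, ht⟩ := exists_isTopDegree (p := fun i ↦ Nontrivial (P.X i))
    (b := b) (fun i hi ↦ not_nontrivial_iff_subsingleton.2 (hb i hi)) ⟨i, hi'⟩
  exact ⟨s, t, hP, hs, ht⟩

lemma homologyAt_iso (i : ℤ) : ∃ n : ℕ, Nonempty
    (HomologyAt (X := fun i ↦ P.X i ⊗[R] C) (tensorDiff (X := fun i ↦ P.X i) P.diff C) i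
      ≃ₗ[R] (Fin n → M)) := by
  obtain ⟨n, ⟨e⟩⟩ := hP.homology_iso (i + 1)
  exact ⟨n, ⟨(P.tensorHomologyEquiv C i).symm.trans e⟩⟩

lemma finite_homologyAt [Module.Finite R M] (i : ℤ) : Module.Finite R
    (HomologyAt (X := fun i ↦ P.X i ⊗[R] C) (tensorDiff (X := fun i ↦ P.X i) P.diff C) i) := by
  obtain ⟨n, ⟨e⟩⟩ := hP.homologyAt_iso i
  exact Module.Finite.equiv e.symm

end IsCQuasiProjectiveResolution

namespace IsResolutionWithDegrees

variable {P : ModuleComplex R} {s t : ℤ}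

omit [IsNoetherianRing R] [IsLocalRing R] in
lemma le (hP : IsResolutionWithDegrees C M P s t) : s ≤ t := by
  by_contra! h
  exact not_subsingleton_iff_nontrivial.2 hP.hsup.1 (subsingleton_homology_tensor P
    (not_nontrivial_iff_subsingleton.1 (hP.sup.2 s h)))

omit [IsNoetherianRing R] [IsLocalRing R] in
lemma subsingleton_homologyAt (hP : IsResolutionWithDegrees C M P (s + 1) t) (i : ℤ) (hi : s < i) :
    Subsingleton (HomologyAt (X := fun i ↦ P.X i ⊗[R] C)
      (tensorDiff (X := fun i ↦ P.X i) P.diff C) i) :=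
  (P.tensorHomologyEquiv C i).toEquiv.subsingleton_congr.1
    (not_nontrivial_iff_subsingleton.1 (hP.hsup.2 (i + 1) (by omega)))

omit [IsNoetherianRing R] [IsLocalRing R] in
lemma nontrivial_homologyAt (hP : IsResolutionWithDegrees C M P (s + 1) t) :
    Nontrivial (HomologyAt (X := fun i ↦ P.X i ⊗[R] C)
      (tensorDiff (X := fun i ↦ P.X i) P.diff C) s) :=
  (P.tensorHomologyEquiv C s).toEquiv.nontrivial_congr.1 hP.hsup.1

omit [IsNoetherianRing R] [IsLocalRing R] in
lemma subsingleton_of_lt (hP : IsResolutionWithDegrees C M P s t) (i : ℤ) (hi : t < i) :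
    Subsingleton (P.X i) :=
  not_nontrivial_iff_subsingleton.1 (hP.sup.2 i hi)

omit [IsLocalRing R] in
/-- Tensoring with a semidualizing module preserves the top homological degree. -/
lemma isTopDegree_homology [Module.Finite R M] (hC : IsSemidualizing R C)
    (hP : IsResolutionWithDegrees C M P s t) : IsTopDegree (fun i ↦ Nontrivial (P.homology i)) s := by
  have := hP.resolution.projective
  have hd := P.diff_comp_diff
  obtain ⟨s, rfl⟩ : ∃ k, s = k + 1 := ⟨s - 1, by ring⟩
  have hb (i : ℤ) (hi : t + 1 ≤ i) : Subsingleton (P.X i) := hP.subsingleton_of_lt i (by omega)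
  constructor
  · have := nontrivial_homology (X := fun i ↦ P.X i) hd hC hb hP.subsingleton_homologyAt
      (hP.resolution.finite_homologyAt s) hP.nontrivial_homologyAt
    exact (P.homologyEquiv s).toEquiv.nontrivial
  · intro i hi
    obtain ⟨i, rfl⟩ : ∃ k, i = k + 1 := ⟨i - 1, by ring⟩
    have := thick_homology (X := fun i ↦ P.X i) hd hC isThickProperty_subsingleton hb
      (n := s + 1) (fun i hi j ↦ by
        have := hP.subsingleton_homologyAt i (by omega)
        exact ModExt.subsingleton_of_subsingleton j) i (by omega)
    exact not_nontrivial_iff_subsingleton.2 (P.homologyEquiv i).toEquiv.subsingleton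

/-- The depth formula for a resolution whose top differential is not injective modulo the maximal
ideal. -/
lemma exists_depth (hP : IsResolutionWithDegrees C M P s (t + 1))
    {x : P.X (t + 1)} (hx : x ∉ maximalIdeal R • (⊤ : Submodule R (P.X (t + 1))))
    (hdx : P.diff t x ∈ maximalIdeal R • (⊤ : Submodule R (P.X t)))
    {c : ℕ} (hlt : ∀ j < c, ResidueExtVanishes (R := R) C j)
    (hc : ¬ ResidueExtVanishes (R := R) C c) :
    ∃ e : ℕ, (c : ℤ) = e + (t + 1 - s) ∧ (∀ j < e, ResidueExtVanishes (R := R) M j) ∧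
      ¬ ResidueExtVanishes (R := R) M e := by
  have := hP.resolution.projective
  have hle := hP.le
  -- `HomologyAt` at index s is the homology in degree s + 1, hence the shift; then δ = t - s is
  -- still top degree minus top homological degree.
  obtain ⟨s, rfl⟩ : ∃ k, s = k + 1 := ⟨s - 1, by ring⟩
  obtain ⟨δ, hδ⟩ := Int.eq_ofNat_of_zero_le (show 0 ≤ t - s by omega)
  obtain ⟨-, b, hb⟩ := P.isBounded_iff.1 hP.resolution.bounded
  obtain ⟨e, h1, h2, h3⟩ := exists_depth_of_not_injective (X := fun i ↦ P.X i ⊗[R] C)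
    (d := tensorDiff (X := fun i ↦ P.X i) P.diff C) (L := ResidueField R)
    (rTensor_comp_rTensor_eq_zero (X := fun i ↦ P.X i) P.diff_comp_diff)
    (s := s) (τ := t) (δ := δ) (c := c) (by omega)
    (fun i j hj ↦ ModExt.subsingleton_tensor (hlt j hj))
    (by
      have := hP.subsingleton_of_lt (t + 1 + 1) (by omega)
      infer_instance)
    hP.subsingleton_homologyAt (not_injective_map_rTensor hc _ hx hdx) (b := b)
    (fun i hi ↦ by
      have := hb i hi
      infer_instance) M hP.resolution.homologyAt_iso hP.nontrivial_homologyAt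
  exact ⟨e, by omega, h2, h3⟩

/-- A resolution whose top differential is injective modulo the maximal ideal can be shortened. -/
lemma exists_shorter [Module.Finite R M] (hC : IsSemidualizing R C)
    (hP : IsResolutionWithDegrees C M P s (t + 1))
    (hmin : ∀ x, P.diff t x ∈ maximalIdeal R • (⊤ : Submodule R (P.X t)) →
      x ∈ maximalIdeal R • (⊤ : Submodule R (P.X (t + 1)))) :
    ∃ (P' : ModuleComplex R) (t' : ℤ), IsResolutionWithDegrees C M P' s t' ∧ t' < t + 1 := by
  have := hC.finite
  have := hP.resolution.projective
  have hd := P.diff_comp_diff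
  obtain ⟨-, b, hb⟩ := P.isBounded_iff.1 hP.resolution.bounded
  have hfin (i : ℤ) : Module.Finite R (HomologyAt (X := fun i ↦ P.X i) P.diff i) :=
    thick_homology (X := fun i ↦ P.X i) (Φ := fun A [AddCommGroup A] [Module R A] ↦
        Module.Finite R A) hd hC isThickProperty_finite
      (b := t + 1 + 1) (n := i) (fun i hi ↦ hP.subsingleton_of_lt i (by omega)) (fun i hi j ↦ by
        have := hP.resolution.finite_homologyAt i
        exact ModuleCat.finite_ext R (ModuleCat.of R C) (ModuleCat.of R _) j) i le_rfl
  have hW : IsStablyFinite R (CokerAt (X := fun i ↦ P.X i) P.diff t) :=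
    isStablyFinite_coker (X := fun i ↦ P.X i) hd hb hfin t
  have hex : Function.Exact (P.diff t) (LinearMap.range (P.diff t)).mkQ := by
    rw [LinearMap.exact_iff, Submodule.ker_mkQ]
  have : Module.Projective R (P.X t ⧸ LinearMap.range (P.diff t)) :=
    hW.projective (.of_presentation hex (Submodule.mkQ_surjective _) hmin)
  obtain ⟨r, hr⟩ := exists_leftInverse_of_projective_coker hex (Submodule.mkQ_surjective _) hmin
  obtain ⟨P', e, i, p, hip, hP'⟩ := P.exists_homotopyEquiv_of_leftInverse r hr
  have hip' (k : ℤ) : (p.f k).hom ∘ₗ (i.f k).hom = LinearMap.id := by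
    rw [← ModuleCat.hom_comp, ← HomologicalComplex.comp_f, hip]
    rfl
  have hsub (k : ℤ) (hk : Subsingleton (P.X k)) : Subsingleton (P'.X k) :=
    have h : Function.Injective (i.f k).hom :=
      Function.LeftInverse.injective (g := (p.f k).hom) (LinearMap.congr_fun (hip' k))
    h.subsingleton
  -- Being additive, - ⊗ C preserves homotopy equivalences, so the homology conditions and s carry
  -- over.
  let eH (k : ℤ) : (P.tensor C).homology k ≃ₗ[R] (P'.tensor C).homology k :=
    (((MonoidalCategory.tensorRight (ModuleCat.of R C)).mapHomotopyEquiv e).toHomologyIso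
      k).toLinearEquiv
  have hres : IsCQuasiProjectiveResolution R C M P' := by
    refine ⟨P'.isBounded_iff.2 ⟨⟨t + 1 + 1, fun k hk ↦ hsub k
      (hP.subsingleton_of_lt k (by omega))⟩, b, fun k hk ↦ hsub k (hb k hk)⟩, fun k ↦ ?_,
      fun hac ↦ ?_, fun k ↦ ?_⟩
    · exact Module.Projective.of_split (i.f k).hom (p.f k).hom (hip' k)
    · refine not_subsingleton_iff_nontrivial.2 hP.hsup.1 ((eH s).toEquiv.subsingleton_congr.2 ?_)
      exact ModuleCat.subsingleton_of_isZero
        ((HomologicalComplex.exactAt_iff_isZero_homology _ _).1 (hac s))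
    · obtain ⟨n, ⟨e'⟩⟩ := hP.resolution.homology_iso k
      exact ⟨n, ⟨(eH k).symm.trans e'⟩⟩
  obtain ⟨s', t', hP''⟩ := hres.exists_degrees
  have hss (a : ℤ) (ha : IsTopDegree (fun i ↦ Nontrivial ((P'.tensor C).homology i)) a) :
      a = s := by
    have h1 : ¬ s < a := fun h ↦ hP.hsup.2 a h ((eH a).toEquiv.nontrivial_congr.2 ha.1)
    have h2 : ¬ a < s := fun h ↦ ha.2 s h ((eH s).toEquiv.nontrivial_congr.1 hP.hsup.1)
    omega
  obtain rfl := hss s' hP''.hsup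
  refine ⟨P', t', hP'', ?_⟩
  by_contra! hlt
  refine not_subsingleton_iff_nontrivial.2 hP''.sup.1 ?_
  obtain rfl | hlt := hlt.eq_or_lt
  · exact hP'
  · exact hsub _ (hP.subsingleton_of_lt _ hlt)

/-- The number n bounds t + 1 - s. Shortening keeps s and lowers the top degree, which can never
drop below s. -/
lemma exists_irreducible [Module.Finite R M] (hC : IsSemidualizing R C) (n : ℕ) :
    ∀ (P : ModuleComplex R) (t : ℤ), IsResolutionWithDegrees C M P s (t + 1) → t + 1 ≤ s + n →
      ∃ (P' : ModuleComplex R) (t' : ℤ), t' ≤ t ∧ IsResolutionWithDegrees C M P' s (t' + 1) ∧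
        ∃ x, x ∉ maximalIdeal R • (⊤ : Submodule R (P'.X (t' + 1))) ∧
          P'.diff t' x ∈ maximalIdeal R • (⊤ : Submodule R (P'.X t')) := by
  induction n with
  | zero =>
    intro P t hP ht
    by_cases h : ∃ x, x ∉ maximalIdeal R • (⊤ : Submodule R (P.X (t + 1))) ∧
          P.diff t x ∈ maximalIdeal R • (⊤ : Submodule R (P.X t))
    · exact ⟨P, t, le_rfl, hP, h⟩
    · push Not at h
      obtain ⟨P', t', hP', hlt⟩ := exists_shorter hC hP fun x hx ↦ by_contra fun h' ↦ h x h' hx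
      have := hP'.le
      omega
  | succ n ih =>
    intro P t hP ht
    by_cases h : ∃ x, x ∉ maximalIdeal R • (⊤ : Submodule R (P.X (t + 1))) ∧
          P.diff t x ∈ maximalIdeal R • (⊤ : Submodule R (P.X t))
    · exact ⟨P, t, le_rfl, hP, h⟩
    · push Not at h
      obtain ⟨P', t', hP', hlt⟩ := exists_shorter hC hP fun x hx ↦ by_contra fun h' ↦ h x h' hx
      obtain ⟨t', rfl⟩ : ∃ k, t' = k + 1 := ⟨t' - 1, by ring⟩
      obtain ⟨P'', t'', h1, h2⟩ := ih P' t' hP' (by push_cast at ht; omega)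
      exact ⟨P'', t'', by omega, h2⟩

omit [IsNoetherianRing R] in
lemma supDeg_sub_hsupDeg_tensor (hC : IsSemidualizing R C)
    (hP : IsResolutionWithDegrees C M P s t) :
    (P.tensor C).supDeg - (P.tensor C).hsupDeg = (((t - s : ℤ) : ℝ) : EReal) := by
  have := hP.resolution.projective
  have := hC.nontrivial
  have htop : IsTopDegree (fun i ↦ Nontrivial ((P.tensor C).X i)) t := by
    constructor
    · have := hP.sup.1
      exact Module.Projective.nontrivial_tensor (P := P.X t) C
    · intro i hi
      have := hP.subsingleton_of_lt i hi
      have : Subsingleton (P.X i ⊗[R] C) := inferInstance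
      exact not_nontrivial_iff_subsingleton.2 this
  rw [supDeg, hsupDeg, htop.iSup_eq, hP.hsup.iSup_eq, ← EReal.coe_sub, ← Int.cast_sub]

omit [IsLocalRing R] in
lemma supDeg_sub_hsupDeg [Module.Finite R M] (hC : IsSemidualizing R C)
    (hP : IsResolutionWithDegrees C M P s t) :
    P.supDeg - P.hsupDeg = (((t - s : ℤ) : ℝ) : EReal) := by
  rw [supDeg, hsupDeg, hP.sup.iSup_eq, (hP.isTopDegree_homology hC).iSup_eq, ← EReal.coe_sub,
    ← Int.cast_sub]

end IsResolutionWithDegrees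

end Resolutions

/-! ### The Auslander–Buchsbaum formula. -/

theorem mainTheorem1 (R : Type u) [CommRing R] [IsNoetherianRing R] [IsLocalRing R]
    (C : Type u) [AddCommGroup C] [Module R C] (hC : IsSemidualizing R C)
    (M : Type u) [AddCommGroup M] [Module R M] [Module.Finite R M] [Nontrivial M]
    (hM : cQuasiProjectiveDim R C M < ⊤) :
    cQuasiProjectiveDim R C M = localDepth R R - localDepth R M ∧
      ∀ F : ModuleComplex R, IsCQuasiProjectiveResolution R C M F → F.IsMinimal →
        cQuasiProjectiveDim R C M = F.supDeg - F.hsupDeg := by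
  obtain ⟨c, hlt, hc, hltR, hcR⟩ := hC.exists_depth
  obtain ⟨P₀, hP₀⟩ : ∃ P, IsCQuasiProjectiveResolution R C M P := by
    by_contra! h
    simp [cQuasiProjectiveDim, h, not_subsingleton M] at hM
  -- Each P is shortened to some P' with the same s that obeys the depth count. Since e = depth M
  -- does not depend on P, the length t' - s = c - e is a universal lower bound, attained by P'.
  have key (P : ModuleComplex R) (hP : IsCQuasiProjectiveResolution R C M P) :
      ∃ (P' : ModuleComplex R) (s t t' : ℤ), t' ≤ t ∧ IsResolutionWithDegrees C M P s t ∧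
        IsResolutionWithDegrees C M P' s t' ∧ ∃ e : ℕ, (c : ℤ) = e + (t' - s) ∧
          localDepth R M = (e : EReal) := by
    obtain ⟨s, t, hst⟩ := hP.exists_degrees
    have hle := hst.le
    obtain ⟨t, rfl⟩ : ∃ k, t = k + 1 := ⟨t - 1, by ring⟩
    obtain ⟨P', t', htt, hP', x, hx, hdx⟩ :=
      IsResolutionWithDegrees.exists_irreducible hC (t + 1 - s).toNat P t hst (by omega)
    obtain ⟨e, he, h1, h2⟩ := hP'.exists_depth hx hdx hlt hc
    exact ⟨P', s, t + 1, t' + 1, by omega, hst, hP', e, he, localDepth_eq h1 h2⟩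
  obtain ⟨P₁, s₀, t₀, t₁, -, -, hP₁, e, he, hdM⟩ := key P₀ hP₀
  have heq (e' : ℕ) (h : localDepth R M = (e' : EReal)) : e' = e := by
    rw [hdM] at h
    exact_mod_cast h.symm
  have hdim : cQuasiProjectiveDim R C M = ((((c : ℤ) - e : ℤ) : ℝ) : EReal) := by
    rw [cQuasiProjectiveDim, if_neg (not_subsingleton M)]
    refine le_antisymm (iInf₂_le_of_le P₁ hP₁.resolution ?_) (le_iInf₂ fun P hP ↦ ?_)
    · rw [hP₁.supDeg_sub_hsupDeg_tensor hC, show t₁ - s₀ = (c : ℤ) - e by omega]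
    · obtain ⟨P', s, t, t', htt, hP, hP', e', he', hdM'⟩ := key P hP
      obtain rfl := heq e' hdM'
      rw [hP.supDeg_sub_hsupDeg_tensor hC, EReal.coe_le_coe_iff]
      exact_mod_cast (show (c : ℤ) - e' ≤ t - s by omega)
  refine ⟨?_, fun F hF hmin ↦ ?_⟩
  · rw [hdim, localDepth_eq hltR hcR, hdM]
    push_cast
    rfl
  · obtain ⟨s, t, hst⟩ := hF.exists_degrees
    have := hF.projective
    obtain ⟨t, rfl⟩ : ∃ k, t = k + 1 := ⟨t - 1, by ring⟩
    have hnt := hst.sup.1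
    -- By Nakayama for projectives the nonzero top term is not 𝔪 times itself. Minimality sends any
    -- such x into 𝔪F_t, so F needs no shortening.
    obtain ⟨x, hx⟩ : ∃ x, x ∉ IsLocalRing.maximalIdeal R • (⊤ : Submodule R (F.X (t + 1))) := by
      by_contra! h
      obtain ⟨y, hy⟩ := exists_ne (0 : F.X (t + 1))
      exact hy (Module.Projective.eq_zero_of_forall_mem_smul h y)
    have hdx : F.diff t x ∈ IsLocalRing.maximalIdeal R • (⊤ : Submodule R (F.X t)) := by
      have H (j : ℤ) (hj : j = t + 1 - 1) : LinearMap.range (F.d (t + 1) j).hom ≤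
          IsLocalRing.maximalIdeal R • ⊤ := by
        subst hj
        exact hmin (t + 1)
      exact H t (by ring) ⟨x, rfl⟩
    obtain ⟨e', he', h1, h2⟩ := hst.exists_depth hx hdx hlt hc
    obtain rfl := heq e' (localDepth_eq h1 h2)
    rw [hdim, hst.supDeg_sub_hsupDeg hC, show t + 1 - s = (c : ℤ) - e' by omega]
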